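/- Proposition (Geometry of $M$). Let $h\ge 1$, let $d_0,\dots,d_h$ be the layer widths of a linear network, and let $X\in\mathbb R^{d_0\times n}$, $Y\in\mathbb R^{d_h\times n}$. Put $r=\min\{d_0,\dots,d_h\}$ and $d_\theta=\sum_{i=0}^{h-1}d_id_{i+1}$. Let $$\mu_d\colon \mathbb R^{d_h\times d_{h-1}}\times\dots\times\mathbb R^{d_1\times d_0}\to\mathbb R^{d_h\times d_0},\qquad (W_h,\dots,W_1)\mapsto W_h\cdots W_1$$ be the matrix multiplication map, let $L(\theta)=\|Y-\mu_d(\theta)X\|^2$ (Frobenius norm) be the quadratic loss, and let $M\subseteq\mathbb R^{d_\theta}$ be the set of global minima of $L$. Assume that $XX^T$ has full rank and that the $\min\{d_h,d_0\}$ singular values of $W_0^*=YX^T(XX^T)^{-1/2}$ are positive and pairwise distinct. Then $M$ is nonempty, $r(d_0+d_h-r)\le d_\theta$, and $M$ is a smooth embedded submanifold of $\mathbb R^{d_\theta}$ of dimension $d_\theta-r(d_0+d_h-r)$. Moreover $M$ is a regular level set of $\mu_d$ in the following sense. The set $\mathcal N_r$ of $(d_h\times d_0)$-matrices of rank exactly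 $r$ is an embedded submanifold of $\mathbb R^{d_h\times d_0}$ of dimension $r(d_0+d_h-r)$; there is $W^*\in\mathcal N_r$ with $M=\mu_d^{-1}(W^*)$; $\mu_d$ maps an open neighbourhood of $M$ smoothly into $\mathcal N_r$; and at each $\theta\in M$ the differential $D\mu_d(\theta)$ has rank $r(d_0+d_h-r)=\dim\mathcal N_r$, so that $\mu_d$ is a submersion to $\mathcal N_r$ at $\theta$. This holds both in the filling case $r=\min\{d_h,d_0\}$ and in the non-filling case $r<\min\{d_h,d_0\}$. In the filling case $D\mu_d(\theta)$ is onto $\mathbb R^{d_h\times d_0}$ for each $\theta\in M$. -/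

import Mathlib

open scoped Matrix ContDiff Manifold Matrix.Norms.Frobenius

noncomputable section

/-- Parameters `θ = (W_h, …, W_1)` of a linear network with `h` layers and widths
`d 0, …, d h` (values of `d` beyond `h` play no role). The entry with index `i : Fin h` is the
matrix `W_{i+1} ∈ ℝ^{d_{i+1} × d_i}`. Each matrix carries the Frobenius norm, which fixes the
standard topology and smooth structure of `ℝ^{d_θ}`. -/
abbrev NetParams (d : ℕ → ℕ) (h : ℕ) : Type :=
  (i : Fin h) → Matrix (Fin (d (i.val + 1))) (Fin (d i.val)) ℝ

/-- The number of parameters, `d_θ = ∑_{i<h} d_i d_{i+1}`. -/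
def paramDim (d : ℕ → ℕ) (h : ℕ) : ℕ :=
  ∑ i ∈ Finset.range h, d i * d (i + 1)

/-- The smallest width, `r = min {d_0, …, d_h}`. -/
def minWidth (d : ℕ → ℕ) (h : ℕ) : ℕ :=
  (Finset.range (h + 1)).inf' Finset.nonempty_range_add_one d

/-- The matrix multiplication map `μ_d (W_h, …, W_1) = W_h ⋯ W_1`. -/
def mulMap (d : ℕ → ℕ) : (h : ℕ) → NetParams d h → Matrix (Fin (d h)) (Fin (d 0)) ℝ
  | 0, _ => 1
  | h + 1, θ => θ ⟨h, h.lt_add_one⟩ * mulMap d h (fun i => θ ⟨i.val, Nat.lt_add_right 1 i.isLt⟩)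

/-- The quadratic loss `l(W) = ‖Y - W X‖²` (Frobenius norm) on matrices. -/
def quadLoss {p q n : ℕ} (X : Matrix (Fin q) (Fin n) ℝ) (Y : Matrix (Fin p) (Fin n) ℝ)
    (W : Matrix (Fin p) (Fin q) ℝ) : ℝ :=
  ‖Y - W * X‖ ^ 2

/-- The loss of the network, `L = l ∘ μ_d`. -/
def netLoss (d : ℕ → ℕ) (h : ℕ) {n : ℕ} (X : Matrix (Fin (d 0)) (Fin n) ℝ)
    (Y : Matrix (Fin (d h)) (Fin n) ℝ) (θ : NetParams d h) : ℝ :=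
  quadLoss X Y (mulMap d h θ)

/-- The set `M` of global minima of `L`. -/
def globalMinima (d : ℕ → ℕ) (h : ℕ) {n : ℕ} (X : Matrix (Fin (d 0)) (Fin n) ℝ)
    (Y : Matrix (Fin (d h)) (Fin n) ℝ) : Set (NetParams d h) :=
  {θ | ∀ θ' : NetParams d h, netLoss d h X Y θ ≤ netLoss d h X Y θ'}

section

open scoped MatrixOrder

/-- The matrix `W₀* = Y Xᵀ (X Xᵀ)^{-1/2}`. -/
def whitenedTarget {p q n : ℕ} (X : Matrix (Fin q) (Fin n) ℝ) (Y : Matrix (Fin p) (Fin n) ℝ) :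
    Matrix (Fin p) (Fin q) ℝ :=
  Y * Xᵀ * (CFC.sqrt (X * Xᵀ))⁻¹

end

/-- The singular values of a `p × q` matrix in decreasing order, `σ_0 ≥ σ_1 ≥ …`. The matrix
proper has the `min p q` singular values `σ_i` with `i < min p q`; the others are `0`. -/
def matSingularValue {p q : ℕ} (A : Matrix (Fin p) (Fin q) ℝ) (i : ℕ) : ℝ :=
  (Matrix.toEuclideanLin A).singularValues i

/-- `S` is a `k`-dimensional embedded smooth (`C^∞`) submanifold of the space `E`: with its
subspace topology it carries the structure of a smooth `k`-manifold for which the inclusion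
into `E` is a smooth embedding. -/
def IsEmbeddedSubmanifold {E : Type} [NormedAddCommGroup E] [NormedSpace ℝ E]
    (k : ℕ) (S : Set E) : Prop :=
  ∃ _ : ChartedSpace (EuclideanSpace ℝ (Fin k)) S,
    IsManifold 𝓘(ℝ, EuclideanSpace ℝ (Fin k)) ∞ S ∧
    Manifold.IsSmoothEmbedding 𝓘(ℝ, EuclideanSpace ℝ (Fin k)) 𝓘(ℝ, E) ∞ (Subtype.val : S → E)

/-- `S` is a regular level set of the map `f`, regarded as a map into `N`: the set `N` is an
`m`-dimensional embedded submanifold, `S = f⁻¹(c)` for a point `c` of `N`, and on an open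
neighbourhood of `S` the map `f` is smooth with values in `N` and its differential has rank
`m = dim N` at each point of `S`. As the differential takes values in the `m`-dimensional tangent
space `T_c N`, this says that it is onto `T_c N`, i.e. `f` is a submersion to `N` there. -/
def IsRegularLevelSet {E F : Type} [NormedAddCommGroup E] [NormedSpace ℝ E]
    [NormedAddCommGroup F] [NormedSpace ℝ F] (f : E → F) (N : Set F) (m : ℕ) (S : Set E) : Prop :=
  IsEmbeddedSubmanifold m N ∧
  (∃ c ∈ N, S = f ⁻¹' {c}) ∧
  ∃ U : Set E, IsOpen U ∧ S ⊆ U ∧ Set.MapsTo f U N ∧ ContDiffOn ℝ ∞ f U ∧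
    ∀ x ∈ S, Module.finrank ℝ (fderiv ℝ f x).range = m

end

/-!
The loss is, up to a constant, the squared Frobenius distance of `W₀* = Y Xᵀ (X Xᵀ)^{-1/2}` to
`W (X Xᵀ)^{1/2}`, where `W = μ_d(θ)` (`exists_quadLoss_eq_norm_sub_sq`), and the products `W` that the
network reaches are exactly the matrices of rank at most `r` (`rank_mulMap_le_minWidth`,
`exists_mulMap_eq`). As the singular values are positive and distinct, there is a gap after the
first `r` of them, and the Eckart–Young theorem in its strict form
(`exists_unique_best_rank_approximation`) gives a unique best `W`, which has rank exactly `r`. So the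
set of global minima is a fibre `μ_d⁻¹(W*)` with `rank W* = r` (`exists_globalMinima_eq_preimage`).

Let `θ` be in this fibre. Near `θ` the rank of `μ_d` is constant, equal to `r`, because it cannot
exceed `r` and the rank is lower semicontinuous. In a basis adapted to `W*` (a `RankFrame`), the
matrices of rank `r` near `W*` are the zeros of the Schur complement of the `r × r` block, a
submersion to a space of dimension `(d_h - r)(d_0 - r)`; and they are determined by their first `r`
rows and columns (`RankFrame.rowsCols`). Thus the range of `Dμ_d(θ)` lies in the kernel of the
differential of the Schur complement. Conversely, varying only the last and the first layer, by
`P W_h` and `W_1 Q`, the range contains all `P W* + W* Q`, whatever the other layers are, and `rowsCols`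
maps these vectors onto its codomain. Counting dimensions, the rank of `Dμ_d(θ)` is `r(d_0 + d_h - r)`,
and the fibre is near `θ` the level set of the submersion `rowsCols ∘ μ_d`.

The submanifold structures come from the inverse function theorem: a submersion is the second
component of a local diffeomorphism, which flattens the level set
(`exists_sliceChart_of_surjective_fderiv`), and slice charts restrict to a smooth atlas for which the
inclusion is an immersion (`isEmbeddedSubmanifold_of_slices`).
-/

/-! ### Submanifolds from slice charts -/

section Slices

variable {E V F : Type*} [TopologicalSpace E] [TopologicalSpace V] [TopologicalSpace F] [Zero F]

/-- The chart of `S` with values in `V` that is cut out by a slice chart `Φ` of the ambient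
space, i.e. a local homeomorphism in which `S` becomes `V × {0}`. The base point `x₀` only serves
as a junk value outside the target. -/
noncomputable def sliceChart {S : Set E} (Φ : OpenPartialHomeomorph E (V × F))
    (hΦ : ∀ y ∈ Φ.source, y ∈ S ↔ (Φ y).2 = 0) (x₀ : S) : OpenPartialHomeomorph S V where
  toFun y := (Φ y).1
  invFun v := open scoped Classical in
    if h : (v, (0 : F)) ∈ Φ.target then
      ⟨Φ.symm (v, 0), (hΦ _ (Φ.map_target h)).2 (by rw [Φ.right_inv h])⟩ else x₀
  source := Subtype.val ⁻¹' Φ.source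
  target := {v | (v, (0 : F)) ∈ Φ.target}
  map_source' y hy := by
    have h0 : (Φ y).2 = 0 := (hΦ _ hy).1 y.2
    have h1 : ((Φ y).1, (0 : F)) = Φ y := by rw [← h0]
    simpa [h1] using Φ.map_source hy
  map_target' v hv := by
    have hv' : (v, (0 : F)) ∈ Φ.target := hv
    simp [hv', Φ.map_target hv']
  left_inv' y hy := by
    have h0 : (Φ y).2 = 0 := (hΦ _ hy).1 y.2
    have h1 : ((Φ y).1, (0 : F)) = Φ y := by rw [← h0]
    have h2 : Φ y ∈ Φ.target := Φ.map_source hy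
    ext
    simp only [h1, h2, dif_pos]
    exact Φ.left_inv hy
  right_inv' v hv := by
    have hv' : (v, (0 : F)) ∈ Φ.target := hv
    simp [hv', Φ.right_inv hv']
  open_source := Φ.open_source.preimage continuous_subtype_val
  open_target := Φ.open_target.preimage (by fun_prop)
  continuousOn_toFun := by
    refine continuous_fst.comp_continuousOn ?_
    exact Φ.continuousOn.comp continuous_subtype_val.continuousOn (fun _ h => h)
  continuousOn_invFun := by
    rw [Topology.IsEmbedding.subtypeVal.continuousOn_iff]
    refine ContinuousOn.congr (f := fun v => Φ.symm (v, (0 : F))) ?_ ?_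
    · exact Φ.continuousOn_symm.comp (by fun_prop) (fun _ h => h)
    · intro v hv
      have hv' : (v, (0 : F)) ∈ Φ.target := hv
      simp [hv']

lemma coe_sliceChart_symm {S : Set E} {Φ : OpenPartialHomeomorph E (V × F)}
    {hΦ : ∀ y ∈ Φ.source, y ∈ S ↔ (Φ y).2 = 0} {x₀ : S} {v : V} (hv : (v, (0 : F)) ∈ Φ.target) :
    (((sliceChart Φ hΦ x₀).symm v : S) : E) = Φ.symm (v, 0) := by
  change (((sliceChart Φ hΦ x₀).invFun v : S) : E) = _
  simp [sliceChart, hv]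

end Slices

/-- A set that is locally flattened by smooth slice charts is an embedded submanifold. -/
theorem isEmbeddedSubmanifold_of_slices {E F : Type} [NormedAddCommGroup E] [NormedSpace ℝ E]
    [NormedAddCommGroup F] [NormedSpace ℝ F] {k : ℕ} {S : Set E}
    (L : (EuclideanSpace ℝ (Fin k) × F) ≃L[ℝ] E)
    (hS : ∀ x : S, ∃ Φ : OpenPartialHomeomorph E (EuclideanSpace ℝ (Fin k) × F),
      (x : E) ∈ Φ.source ∧ ContDiffOn ℝ ∞ Φ Φ.source ∧ ContDiffOn ℝ ∞ Φ.symm Φ.target ∧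
      ∀ y ∈ Φ.source, y ∈ S ↔ (Φ y).2 = 0) :
    IsEmbeddedSubmanifold k S := by
  choose Φ hx hΦ hΦs hslice using hS
  let c : S → OpenPartialHomeomorph S (EuclideanSpace ℝ (Fin k)) :=
    fun x => sliceChart (Φ x) (hslice x) x
  let cs : ChartedSpace (EuclideanSpace ℝ (Fin k)) S :=
    { atlas := Set.range c
      chartAt := c
      mem_chart_source := fun x => hx x
      chart_mem_atlas := fun x => ⟨x, rfl⟩ }
  have hman : IsManifold 𝓘(ℝ, EuclideanSpace ℝ (Fin k)) ∞ S := by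
    apply isManifold_of_contDiffOn
    rintro _ _ ⟨x, rfl⟩ ⟨y, rfl⟩
    have key : ContDiffOn ℝ ∞ (fun v => (Φ y ((Φ x).symm (v, (0 : F)))).1)
        ((c x).symm.trans (c y)).source := by
      refine contDiff_fst.comp_contDiffOn ((hΦ y).comp
        ((hΦs x).comp (by fun_prop) ?_) ?_)
      · intro v hv
        exact hv.1
      · intro v hv
        have h1 : (v, (0 : F)) ∈ (Φ x).target := hv.1
        have h2 : (((c x).symm v : S) : E) ∈ (Φ y).source := hv.2
        rwa [coe_sliceChart_symm h1] at h2
    refine (key.congr ?_).mono ?_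
    · intro v hv
      have h1 : (v, (0 : F)) ∈ (Φ x).target := hv.1
      change (Φ y (((c x).symm v : S) : E)).1 = _
      rw [coe_sliceChart_symm h1]
    · intro v hv
      exact hv.1
  refine ⟨cs, hman, ?_, Topology.IsEmbedding.subtypeVal⟩
  refine Manifold.IsImmersionOfComplement.isImmersion (F := F) fun x => ?_
  have hcod : (Φ x).trans L.toHomeomorph.toOpenPartialHomeomorph ∈
      IsManifold.maximalAtlas 𝓘(ℝ, E) ∞ E := by
    refine StructureGroupoid.mem_maximalAtlas_of_mem_groupoid _ ?_
    rw [contDiffGroupoid, mem_groupoid_of_pregroupoid]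
    constructor
    · refine ContDiffOn.mono (s := (Φ x).source) ?_ ?_
      · exact L.contDiff.comp_contDiffOn (hΦ x)
      · intro v hv
        exact hv.1.1
    · refine ContDiffOn.mono (s := L.symm ⁻¹' (Φ x).target) ?_ ?_
      · exact (hΦs x).comp L.symm.contDiff.contDiffOn (fun _ h => h)
      · intro v hv
        exact hv.1.2
  refine Manifold.IsImmersionAtOfComplement.mk_of_charts L (c x)
    ((Φ x).trans L.toHomeomorph.toOpenPartialHomeomorph) (hx x) ?_
    (IsManifold.chart_mem_maximalAtlas x) hcod ?_ ?_
  · exact ⟨hx x, trivial⟩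
  · intro y hy
    exact ⟨hy, trivial⟩
  · intro v hv
    have h1 : (v, (0 : F)) ∈ (Φ x).target := by
      simpa using! hv
    change L (Φ x (((c x).symm v : S) : E)) = L (v, 0)
    rw [coe_sliceChart_symm h1, (Φ x).right_inv h1]

/-! ### Level sets of submersions -/

/-- A smooth submersion onto `ℝᵐ` extends to a local diffeomorphism with `ℝᵏ × ℝᵐ` that has
the submersion as second component; this flattens the level sets. -/
theorem exists_sliceChart_of_surjective_fderiv {E F : Type*} [NormedAddCommGroup E]
    [NormedSpace ℝ E] [FiniteDimensional ℝ E] [NormedAddCommGroup F] [NormedSpace ℝ F]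
    [FiniteDimensional ℝ F] {k m : ℕ} (hE : Module.finrank ℝ E = k + m)
    (hF : Module.finrank ℝ F = m) {g : E → F} {U : Set E} (hU : IsOpen U) {x : E} (hx : x ∈ U)
    (hg : ContDiffOn ℝ ∞ g U) (hs : Function.Surjective (fderiv ℝ g x)) :
    ∃ Φ : OpenPartialHomeomorph E (EuclideanSpace ℝ (Fin k) × EuclideanSpace ℝ (Fin m)),
      x ∈ Φ.source ∧ Φ.source ⊆ U ∧ ContDiffOn ℝ ∞ Φ Φ.source ∧
      ContDiffOn ℝ ∞ Φ.symm Φ.target ∧ ∀ y ∈ Φ.source, g y = g x ↔ (Φ y).2 = 0 := by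
  have : CompleteSpace E := FiniteDimensional.complete ℝ E
  let e : F ≃L[ℝ] EuclideanSpace ℝ (Fin m) :=
    ContinuousLinearEquiv.ofFinrankEq (by rw [hF, finrank_euclideanSpace_fin])
  have hgx : ContDiffAt ℝ ∞ g x := hg.contDiffAt (hU.mem_nhds hx)
  let D : E →L[ℝ] F := fderiv ℝ g x
  have hD : HasFDerivAt g D x := (hgx.differentiableAt (by simp)).hasFDerivAt
  have hDr : D.range = ⊤ := LinearMap.range_eq_top.2 hs
  have hker : Module.finrank ℝ D.ker = k := by
    have h1 := D.toLinearMap.finrank_range_add_finrank_ker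
    have h2 : Module.finrank ℝ D.range = m := by rw [hDr, finrank_top, hF]
    change Module.finrank ℝ D.range + Module.finrank ℝ D.ker = _ at h1
    omega
  obtain ⟨p, hp⟩ := D.ker_closedComplemented_of_finiteDimensional_range
  let e' : D.ker ≃L[ℝ] EuclideanSpace ℝ (Fin k) :=
    ContinuousLinearEquiv.ofFinrankEq (by rw [hker, finrank_euclideanSpace_fin])
  let f₁ : E →L[ℝ] EuclideanSpace ℝ (Fin k) := e'.toContinuousLinearMap.comp p
  let f₂ : E →L[ℝ] EuclideanSpace ℝ (Fin m) := e.toContinuousLinearMap.comp D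
  have hf₁ : f₁.range = ⊤ := by
    refine LinearMap.range_eq_top.2 (e'.surjective.comp fun z => ⟨z, hp z⟩)
  have hf₂ : f₂.range = ⊤ := LinearMap.range_eq_top.2 (e.surjective.comp hs)
  have hcompl : IsCompl f₁.ker f₂.ker := by
    have h1 : f₁.ker = p.ker := by ext z; simp [f₁]
    have h2 : f₂.ker = D.ker := by ext z; simp [f₂]
    rw [h1, h2]
    exact (LinearMap.isCompl_of_proj hp).symm
  let L := f₁.equivProdOfSurjectiveOfIsCompl f₂ hf₁ hf₂ hcompl
  let φ : E → EuclideanSpace ℝ (Fin k) × EuclideanSpace ℝ (Fin m) :=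
    fun y => (f₁ y, e (g y) - e (g x))
  have hφ : ContDiffOn ℝ ∞ φ U :=
    f₁.contDiff.contDiffOn.prodMk ((e.contDiff.comp_contDiffOn hg).sub contDiffOn_const)
  have hφx : ContDiffAt ℝ ∞ φ x := hφ.contDiffAt (hU.mem_nhds hx)
  have hφ' : HasFDerivAt φ (L : E →L[ℝ] _) x :=
    f₁.hasFDerivAt.prodMk ((e.hasFDerivAt.comp x hD).sub_const _)
  let Ψ := hφx.toOpenPartialHomeomorph φ hφ' (by simp)
  have hΨ : ∀ y, Ψ y = φ y := fun y => rfl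
  have hcont : ContinuousOn (fderiv ℝ φ) U := hφ.continuousOn_fderiv_of_isOpen hU (by simp)
  have hV : IsOpen (U ∩ fderiv ℝ φ ⁻¹' Set.range ((↑) :
      (E ≃L[ℝ] EuclideanSpace ℝ (Fin k) × EuclideanSpace ℝ (Fin m)) → E →L[ℝ] _)) :=
    hcont.isOpen_inter_preimage hU ContinuousLinearEquiv.isOpen
  refine ⟨Ψ.restrOpen _ hV, ⟨hφx.mem_toOpenPartialHomeomorph_source hφ' (by simp), hx,
    ⟨L, hφ'.fderiv.symm⟩⟩, fun y hy => hy.2.1, hφ.mono fun y hy => hy.2.1, ?_, ?_⟩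
  · intro v hv
    have hv' := (Ψ.restrOpen _ hV).map_target hv
    obtain ⟨hy1, hy2, ⟨L', hL'⟩⟩ := hv'
    have hc : ContDiffAt ℝ ∞ φ (Ψ.symm v) := hφ.contDiffAt (hU.mem_nhds hy2)
    have hd : HasFDerivAt φ (L' : E →L[ℝ] _) (Ψ.symm v) := by
      rw [hL']
      exact (hc.differentiableAt (by simp)).hasFDerivAt
    exact (Ψ.contDiffAt_symm hv.1 hd hc).contDiffWithinAt
  · intro y hy
    change _ ↔ e (g y) - e (g x) = 0
    rw [sub_eq_zero, e.injective.eq_iff]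

/-- The regular level set criterion: a set that is locally a level set of a submersion to an
`m`-dimensional space is an embedded submanifold of codimension `m`. -/
theorem isEmbeddedSubmanifold_of_surjective_fderiv {E F : Type} [NormedAddCommGroup E]
    [NormedSpace ℝ E] [FiniteDimensional ℝ E] [NormedAddCommGroup F] [NormedSpace ℝ F]
    [FiniteDimensional ℝ F] {k m : ℕ} {S : Set E} (hE : Module.finrank ℝ E = k + m)
    (hF : Module.finrank ℝ F = m)
    (hS : ∀ x ∈ S, ∃ (g : E → F) (U : Set E), IsOpen U ∧ x ∈ U ∧ ContDiffOn ℝ ∞ g U ∧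
      Function.Surjective (fderiv ℝ g x) ∧ ∀ y ∈ U, y ∈ S ↔ g y = g x) :
    IsEmbeddedSubmanifold k S := by
  have L : (EuclideanSpace ℝ (Fin k) × EuclideanSpace ℝ (Fin m)) ≃L[ℝ] E :=
    ContinuousLinearEquiv.ofFinrankEq (by simp [hE])
  refine isEmbeddedSubmanifold_of_slices L fun x => ?_
  obtain ⟨g, U, hU, hxU, hg, hs, hgS⟩ := hS x x.2
  obtain ⟨Φ, h1, h2, h3, h4, h5⟩ := exists_sliceChart_of_surjective_fderiv hE hF hU hxU hg hs
  exact ⟨Φ, h1, h3, h4, fun y hy => (hgS y (h2 hy)).trans (h5 y hy)⟩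

/-! ### Frames adapted to a matrix of rank `r` -/

section RankFactorization

variable {K m n : Type*} [Field K] [Fintype m] [Fintype n] [DecidableEq m] [DecidableEq n]

/-- Rank factorization: a matrix of rank `r` factors through `Kʳ` as a left invertible matrix times
a right invertible one. -/
theorem Matrix.exists_rank_factorization (W : Matrix m n K) :
    ∃ (A : Matrix m (Fin W.rank) K) (A' : Matrix (Fin W.rank) m K)
      (B : Matrix (Fin W.rank) n K) (B' : Matrix n (Fin W.rank) K),
      A' * A = 1 ∧ B * B' = 1 ∧ W = A * B := by
  let f := Matrix.toLin' W
  have hr : Module.finrank K (LinearMap.range f) = Module.finrank K (Fin W.rank → K) := by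
    rw [Module.finrank_fin_fun]; rfl
  let e : LinearMap.range f ≃ₗ[K] (Fin W.rank → K) := LinearEquiv.ofFinrankEq _ _ hr
  let a : (Fin W.rank → K) →ₗ[K] (m → K) := (LinearMap.range f).subtype ∘ₗ e.symm.toLinearMap
  let b : (n → K) →ₗ[K] (Fin W.rank → K) := e.toLinearMap ∘ₗ f.rangeRestrict
  have ha : LinearMap.ker a = ⊥ :=
    LinearMap.ker_eq_bot.2 (Subtype.val_injective.comp e.symm.injective)
  have hb : LinearMap.range b = ⊤ :=
    LinearMap.range_eq_top.2 (e.surjective.comp f.surjective_rangeRestrict)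
  obtain ⟨a', ha'⟩ := a.exists_leftInverse_of_injective ha
  obtain ⟨b', hb'⟩ := b.exists_rightInverse_of_surjective hb
  refine ⟨a.toMatrix', a'.toMatrix', b.toMatrix', b'.toMatrix', ?_, ?_, ?_⟩
  · rw [← LinearMap.toMatrix'_comp, ha', LinearMap.toMatrix'_id]
  · rw [← LinearMap.toMatrix'_comp, hb', LinearMap.toMatrix'_id]
  · rw [← LinearMap.toMatrix'_comp]
    have : a ∘ₗ b = f := by ext; simp [a, b]
    rw [this, LinearMap.toMatrix'_toLin']

/-- A left invertible matrix extends to an invertible square matrix: the columns that are added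
form a basis of the kernel of the left inverse. -/
theorem Matrix.exists_complement_of_mul_eq_one {p r : ℕ} {A : Matrix (Fin p) (Fin r) K}
    {A' : Matrix (Fin r) (Fin p) K} (h : A' * A = 1) :
    ∃ (C : Matrix (Fin p) (Fin (p - r)) K) (C' : Matrix (Fin (p - r)) (Fin p) K),
      C' * C = 1 ∧ A * A' + C * C' = 1 := by
  let a := Matrix.toLin' A
  let a' := Matrix.toLin' A'
  have haa : a' ∘ₗ a = LinearMap.id := by
    rw [← Matrix.toLin'_mul, h, Matrix.toLin'_one]
  have haa' : ∀ v, a' (a v) = v := fun v => LinearMap.congr_fun haa v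
  have hsurj : LinearMap.range a' = ⊤ := LinearMap.range_eq_top.2 fun v => ⟨a v, haa' v⟩
  have hk : Module.finrank K (LinearMap.ker a') = p - r := by
    have h1 := a'.finrank_range_add_finrank_ker
    rw [hsurj, finrank_top, Module.finrank_fin_fun, Module.finrank_fin_fun] at h1
    omega
  let e : LinearMap.ker a' ≃ₗ[K] (Fin (p - r) → K) :=
    LinearEquiv.ofFinrankEq _ _ (by rw [hk, Module.finrank_fin_fun])
  let c : (Fin (p - r) → K) →ₗ[K] (Fin p → K) := (LinearMap.ker a').subtype ∘ₗ e.symm.toLinearMap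
  let π : (Fin p → K) →ₗ[K] LinearMap.ker a' :=
    (LinearMap.id - a ∘ₗ a').codRestrict (LinearMap.ker a') fun v => by simp [haa']
  let c' := e.toLinearMap ∘ₗ π
  have hπ : ∀ v : LinearMap.ker a', π v = v := by
    intro v
    have hv : a' v = 0 := v.2
    ext1
    simp [π, hv]
  refine ⟨c.toMatrix', c'.toMatrix', ?_, ?_⟩
  · have : c' ∘ₗ c = LinearMap.id := by
      refine LinearMap.ext fun v => ?_
      simp [c', c, hπ]
    rw [← LinearMap.toMatrix'_comp, this, LinearMap.toMatrix'_id]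
  · have : c ∘ₗ c' = LinearMap.id - a ∘ₗ a' := by
      refine LinearMap.ext fun v => ?_
      simp [c', c, π]
    rw [← LinearMap.toMatrix'_comp, this, map_sub, LinearMap.toMatrix'_comp,
      LinearMap.toMatrix'_toLin', LinearMap.toMatrix'_toLin', LinearMap.toMatrix'_id]
    abel

omit [Fintype n] [DecidableEq m] [DecidableEq n] in
lemma Matrix.mul_eq_zero_of_add_mul_eq_one {k l : Type*} [DecidableEq m] [Fintype k] [Fintype l]
    [DecidableEq k] [DecidableEq l] {A : Matrix m k K} {A' : Matrix k m K} {C : Matrix m l K}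
    {C' : Matrix l m K} (hA : A' * A = 1) (hC : C' * C = 1) (h : A * A' + C * C' = 1) :
    A' * C = 0 := by
  have h' : A' * ((A * A' + C * C') * C) = A' * C := by rw [h, Matrix.one_mul]
  rw [Matrix.add_mul, Matrix.mul_assoc C, hC, Matrix.mul_one, Matrix.mul_add,
    ← Matrix.mul_assoc, ← Matrix.mul_assoc, hA, Matrix.one_mul] at h'
  simpa using h'

end RankFactorization

/-- A frame adapted to a matrix `W = A * B` of rank `r`: `A` is completed by `A₁` to an invertible
`p × p` matrix with inverse `(A', A₁')`, and `B` by `B₁` to an invertible `q × q` matrix with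
inverse `(B', B₁')`. In the bases given by the frame `W` becomes `diag (1_r, 0)`. -/
structure RankFrame {p q : ℕ} (W : Matrix (Fin p) (Fin q) ℝ) (r : ℕ) where
  /-- a basis of the column space of `W` -/
  A : Matrix (Fin p) (Fin r) ℝ
  /-- a left inverse of `A` -/
  A' : Matrix (Fin r) (Fin p) ℝ
  /-- a basis of the complement `ker A'` of the column space -/
  A₁ : Matrix (Fin p) (Fin (p - r)) ℝ
  /-- the coordinates on `ker A'` -/
  A₁' : Matrix (Fin (p - r)) (Fin p) ℝ
  /-- a basis of the row space of `W` -/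
  B : Matrix (Fin r) (Fin q) ℝ
  /-- a right inverse of `B` -/
  B' : Matrix (Fin q) (Fin r) ℝ
  /-- the coordinates on `ker B` -/
  B₁ : Matrix (Fin (q - r)) (Fin q) ℝ
  /-- a basis of `ker B` -/
  B₁' : Matrix (Fin q) (Fin (q - r)) ℝ
  factor : W = A * B
  A'_A : A' * A = 1
  A₁'_A₁ : A₁' * A₁ = 1
  A_split : A * A' + A₁ * A₁' = 1
  B_B' : B * B' = 1
  B₁_B₁' : B₁ * B₁' = 1
  B_split : B' * B + B₁' * B₁ = 1

theorem nonempty_rankFrame {p q r : ℕ} {W : Matrix (Fin p) (Fin q) ℝ} (h : W.rank = r) :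
    Nonempty (RankFrame W r) := by
  subst h
  obtain ⟨A, A', B, B', hA, hB, hW⟩ := W.exists_rank_factorization
  obtain ⟨C, C', h1, h2⟩ := Matrix.exists_complement_of_mul_eq_one hA
  obtain ⟨D, D', h3, h4⟩ := Matrix.exists_complement_of_mul_eq_one hB
  exact ⟨⟨A, A', C, C', B, B', D', D, hW, hA, h1, h2, hB, h3, h4⟩⟩

namespace RankFrame

variable {p q r : ℕ} {W₀ : Matrix (Fin p) (Fin q) ℝ} (f : RankFrame W₀ r)

lemma A'_mul_A₁ : f.A' * f.A₁ = 0 :=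
  Matrix.mul_eq_zero_of_add_mul_eq_one f.A'_A f.A₁'_A₁ f.A_split

lemma A₁'_mul_A : f.A₁' * f.A = 0 :=
  Matrix.mul_eq_zero_of_add_mul_eq_one f.A₁'_A₁ f.A'_A (by rw [add_comm, f.A_split])

lemma B₁_mul_B' : f.B₁ * f.B' = 0 :=
  Matrix.mul_eq_zero_of_add_mul_eq_one f.B₁_B₁' f.B_B' (by rw [add_comm, f.B_split])

lemma A'_mul_self : f.A' * W₀ = f.B := by
  have h := congrArg (f.A' * ·) f.factor
  simpa only [← Matrix.mul_assoc, f.A'_A, Matrix.one_mul] using h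

lemma self_mul_B' : W₀ * f.B' = f.A := by
  have h := congrArg (· * f.B') f.factor
  simpa only [Matrix.mul_assoc, f.B_B', Matrix.mul_one] using h

/-- The `r × r` block of `W` in the bases of the frame. -/
noncomputable def block (W : Matrix (Fin p) (Fin q) ℝ) : Matrix (Fin r) (Fin r) ℝ := f.A' * W * f.B'

lemma block_self : f.block W₀ = 1 := by
  rw [block, f.A'_mul_self, f.B_B']

lemma rank_ge_of_isUnit_block {W : Matrix (Fin p) (Fin q) ℝ} (hW : IsUnit (f.block W)) :
    r ≤ W.rank := by
  have h1 : (f.block W).rank = r := by rw [Matrix.rank_of_isUnit _ hW, Fintype.card_fin]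
  calc r = (f.A' * W * f.B').rank := h1.symm
    _ ≤ (f.A' * W).rank := Matrix.rank_mul_le_left _ _
    _ ≤ W.rank := Matrix.rank_mul_le_right _ _

/-- A matrix of rank `r` with invertible `r × r` block is recovered from its first `r` rows and
columns. -/
lemma eq_of_rank_eq {W : Matrix (Fin p) (Fin q) ℝ} (hW : IsUnit (f.block W)) (hr : W.rank = r) :
    W * f.B' * (f.block W)⁻¹ * (f.A' * W) = W := by
  obtain ⟨C, C', D, D', -, -, hCD⟩ : ∃ (A : Matrix (Fin p) (Fin r) ℝ) (A' : Matrix (Fin r) (Fin p) ℝ)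
      (B : Matrix (Fin r) (Fin q) ℝ) (B' : Matrix (Fin q) (Fin r) ℝ),
      A' * A = 1 ∧ B * B' = 1 ∧ W = A * B := by
    subst hr
    exact W.exists_rank_factorization
  have hblock : f.block W = f.A' * C * (D * f.B') := by
    rw [block, hCD]; simp only [Matrix.mul_assoc]
  rw [hblock, Matrix.isUnit_iff_isUnit_det, Matrix.det_mul] at hW
  have h1 := isUnit_of_mul_isUnit_left hW
  have h2 := isUnit_of_mul_isUnit_right hW
  calc W * f.B' * (f.block W)⁻¹ * (f.A' * W)
      = C * ((D * f.B') * (D * f.B')⁻¹) * ((f.A' * C)⁻¹ * (f.A' * C)) * D := by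
        rw [hblock, Matrix.mul_inv_rev, hCD]
        simp only [Matrix.mul_assoc]
    _ = W := by
        rw [Matrix.mul_nonsing_inv _ h2, Matrix.nonsing_inv_mul _ h1, Matrix.mul_one,
          Matrix.mul_one, hCD]

/-- The Schur complement of the `r × r` block of `W` in the bases of the frame. Where the block is
invertible, the matrices of rank `r` are its zeros. -/
noncomputable def schur (W : Matrix (Fin p) (Fin q) ℝ) : Matrix (Fin (p - r)) (Fin (q - r)) ℝ :=
  f.A₁' * (W - W * f.B' * (f.block W)⁻¹ * (f.A' * W)) * f.B₁'

lemma rank_eq_iff_schur_eq_zero {W : Matrix (Fin p) (Fin q) ℝ} (hW : IsUnit (f.block W)) :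
    W.rank = r ↔ f.schur W = 0 := by
  constructor
  · intro h
    rw [schur, f.eq_of_rank_eq hW h, sub_self, Matrix.mul_zero, Matrix.zero_mul]
  · intro h
    have hdet := (Matrix.isUnit_iff_isUnit_det _).1 hW
    set Z := W - W * f.B' * (f.block W)⁻¹ * (f.A' * W) with hZ
    have h1 : f.A' * Z = 0 := by
      have : f.A' * (W * f.B' * (f.block W)⁻¹ * (f.A' * W)) =
          f.block W * (f.block W)⁻¹ * (f.A' * W) := by
        simp only [block, Matrix.mul_assoc]
      rw [hZ, Matrix.mul_sub, this, Matrix.mul_nonsing_inv _ hdet, Matrix.one_mul, sub_self]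
    have h2 : Z * f.B' = 0 := by
      have : W * f.B' * (f.block W)⁻¹ * (f.A' * W) * f.B' =
          W * f.B' * ((f.block W)⁻¹ * f.block W) := by
        simp only [block, Matrix.mul_assoc]
      rw [hZ, Matrix.sub_mul, this, Matrix.nonsing_inv_mul _ hdet, Matrix.mul_one, sub_self]
    have hZ0 : Z = 0 := by
      calc Z = (f.A * f.A' + f.A₁ * f.A₁') * Z * (f.B' * f.B + f.B₁' * f.B₁) := by
            rw [f.A_split, f.B_split, Matrix.one_mul, Matrix.mul_one]
        _ = f.A * (f.A' * Z) * (f.B' * f.B + f.B₁' * f.B₁) + f.A₁ * (f.A₁' * (Z * f.B')) * f.B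
            + f.A₁ * (f.A₁' * Z * f.B₁') * f.B₁ := by
            simp only [Matrix.add_mul, Matrix.mul_add, Matrix.mul_assoc]
            abel
        _ = 0 := by
            rw [h1, h2, show f.A₁' * Z * f.B₁' = 0 from h]
            simp
    have hW' : W = W * f.B' * (f.block W)⁻¹ * (f.A' * W) := sub_eq_zero.1 hZ0
    refine le_antisymm ?_ (f.rank_ge_of_isUnit_block hW)
    rw [hW']
    refine (Matrix.rank_mul_le_right _ _).trans ?_
    exact (Matrix.rank_le_card_height _).trans (by simp)

/-- The first `r` rows of `W` and the remaining part of the first `r` columns, in the bases of the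
frame. Restricted to the tangent space at `W₀` of the matrices of rank `r`, this is a linear
isomorphism. -/
noncomputable def rowsCols : Matrix (Fin p) (Fin q) ℝ →ₗ[ℝ]
    Matrix (Fin r) (Fin q) ℝ × Matrix (Fin (p - r)) (Fin r) ℝ where
  toFun W := (f.A' * W, f.A₁' * W * f.B')
  map_add' W V := by simp [Matrix.mul_add, Matrix.add_mul]
  map_smul' c W := by simp

lemma rowsCols_apply (W : Matrix (Fin p) (Fin q) ℝ) :
    f.rowsCols W = (f.A' * W, f.A₁' * W * f.B') := rfl

lemma eq_of_rowsCols_eq {W V : Matrix (Fin p) (Fin q) ℝ} (hW : IsUnit (f.block W))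
    (hrW : W.rank = r) (hrV : V.rank = r) (h : f.rowsCols W = f.rowsCols V) : W = V := by
  rw [rowsCols_apply, rowsCols_apply, Prod.mk.injEq] at h
  obtain ⟨h1, h2⟩ := h
  have hb : f.block W = f.block V := by rw [block, block, h1]
  have hcol : W * f.B' = V * f.B' := by
    calc W * f.B' = (f.A * f.A' + f.A₁ * f.A₁') * W * f.B' := by rw [f.A_split, Matrix.one_mul]
      _ = f.A * (f.A' * W) * f.B' + f.A₁ * (f.A₁' * W * f.B') := by
        simp only [Matrix.add_mul, Matrix.mul_assoc]
      _ = f.A * (f.A' * V) * f.B' + f.A₁ * (f.A₁' * V * f.B') := by rw [h1, h2]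
      _ = (f.A * f.A' + f.A₁ * f.A₁') * V * f.B' := by
        simp only [Matrix.add_mul, Matrix.mul_assoc]
      _ = V * f.B' := by rw [f.A_split, Matrix.one_mul]
  rw [← f.eq_of_rank_eq hW hrW, ← f.eq_of_rank_eq (hb ▸ hW) hrV, hcol, hb, h1]

/-- The vectors `P * W₀ + W₀ * Q`, which are tangent to the orbit of `W₀` under row and column
operations, fill the space parametrized by `rowsCols`. -/
lemma exists_rowsCols_eq (z : Matrix (Fin r) (Fin q) ℝ × Matrix (Fin (p - r)) (Fin r) ℝ) :
    ∃ (P : Matrix (Fin p) (Fin p) ℝ) (Q : Matrix (Fin q) (Fin q) ℝ),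
      f.rowsCols (P * W₀ + W₀ * Q) = z := by
  refine ⟨f.A₁ * z.2 * f.A', f.B' * z.1, ?_⟩
  have h1 : f.A₁ * z.2 * f.A' * W₀ = f.A₁ * z.2 * f.B := by
    rw [Matrix.mul_assoc _ f.A', f.A'_mul_self]
  have h2 : W₀ * (f.B' * z.1) = f.A * z.1 := by
    rw [← Matrix.mul_assoc, f.self_mul_B']
  rw [h1, h2, rowsCols_apply]
  ext1
  · simp only [Matrix.mul_add, ← Matrix.mul_assoc, f.A'_mul_A₁, f.A'_A, Matrix.zero_mul,
      Matrix.one_mul, zero_add]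
  · simp only [Matrix.mul_add, ← Matrix.mul_assoc, f.A₁'_A₁, f.A₁'_mul_A,
      Matrix.zero_mul, Matrix.one_mul, add_zero]
    rw [Matrix.mul_assoc, f.B_B', Matrix.mul_one]

end RankFrame

/-! ### The manifold of matrices of rank `r` -/

section MatrixCalculus

variable {l m n : Type*} [Fintype l] [Fintype m] [Fintype n]
  {X : Type*} [NormedAddCommGroup X] [NormedSpace ℝ X]

theorem Matrix.isBoundedBilinearMap_mul :
    IsBoundedBilinearMap ℝ fun p : Matrix l m ℝ × Matrix m n ℝ => p.1 * p.2 where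
  add_left := Matrix.add_mul
  smul_left c A B := Matrix.smul_mul c A B
  add_right := Matrix.mul_add
  smul_right c A B := Matrix.mul_smul A c B
  bound := ⟨1, one_pos, fun A B => by
    rw [one_mul]; exact Matrix.frobenius_norm_mul A B⟩

theorem ContDiffOn.matrix_mul {f : X → Matrix l m ℝ} {g : X → Matrix m n ℝ} {s : Set X}
    {k : WithTop ℕ∞} (hf : ContDiffOn ℝ k f s) (hg : ContDiffOn ℝ k g s) :
    ContDiffOn ℝ k (fun x => f x * g x) s :=
  (Matrix.isBoundedBilinearMap_mul (l := l) (m := m) (n := n)).contDiff.comp_contDiffOn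
    (hf.prodMk hg)

theorem ContDiffOn.matrix_inv [DecidableEq m] {f : X → Matrix m m ℝ} {s : Set X}
    {k : WithTop ℕ∞} (hf : ContDiffOn ℝ k f s) (h : ∀ x ∈ s, IsUnit (f x)) :
    ContDiffOn ℝ k (fun x => (f x)⁻¹) s := by
  have : CompleteSpace (Matrix m m ℝ) := FiniteDimensional.complete ℝ _
  intro x hx
  obtain ⟨u, hu⟩ := h x hx
  simp only [Matrix.nonsing_inv_eq_ringInverse]
  have h1 : ContDiffAt ℝ k Ring.inverse (f x) := hu ▸ contDiffAt_ringInverse ℝ u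
  exact h1.comp_contDiffWithinAt x (hf x hx)

end MatrixCalculus

namespace RankFrame

variable {p q r : ℕ} {W₀ : Matrix (Fin p) (Fin q) ℝ} (f : RankFrame W₀ r)

lemma contDiff_block : ContDiff ℝ ∞ f.block := by
  rw [← contDiffOn_univ]
  exact (contDiffOn_const.matrix_mul contDiffOn_id).matrix_mul contDiffOn_const

lemma isOpen_isUnit_block : IsOpen {W | IsUnit (f.block W)} := by
  have : CompleteSpace (Matrix (Fin r) (Fin r) ℝ) := FiniteDimensional.complete ℝ _
  exact Units.isOpen.preimage f.contDiff_block.continuous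

lemma contDiffOn_schur : ContDiffOn ℝ ∞ f.schur {W | IsUnit (f.block W)} := by
  have h : ContDiffOn ℝ ∞ (fun W => (f.block W)⁻¹) {W | IsUnit (f.block W)} :=
    f.contDiff_block.contDiffOn.matrix_inv fun _ h => h
  exact (contDiffOn_const.matrix_mul (contDiffOn_id.sub
    (((contDiffOn_id.matrix_mul contDiffOn_const).matrix_mul h).matrix_mul
      (contDiffOn_const.matrix_mul contDiffOn_id)))).matrix_mul contDiffOn_const

/-- The Schur complement is the identity along the complementary block of the frame. -/
lemma schur_add (Z : Matrix (Fin (p - r)) (Fin (q - r)) ℝ) :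
    f.schur (W₀ + f.A₁ * Z * f.B₁) = Z := by
  have h1 : f.A' * (W₀ + f.A₁ * Z * f.B₁) = f.B := by
    simp only [Matrix.mul_add, ← Matrix.mul_assoc, f.A'_mul_A₁, Matrix.zero_mul, add_zero,
      f.A'_mul_self]
  have h2 : (W₀ + f.A₁ * Z * f.B₁) * f.B' = f.A := by
    simp only [Matrix.add_mul, Matrix.mul_assoc, f.B₁_mul_B', Matrix.mul_zero, add_zero,
      f.self_mul_B']
  have h3 : f.block (W₀ + f.A₁ * Z * f.B₁) = 1 := by rw [block, h1, f.B_B']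
  rw [schur, h1, h2, h3, inv_one, Matrix.mul_one, ← f.factor, add_sub_cancel_left]
  rw [Matrix.mul_assoc f.A₁, ← Matrix.mul_assoc f.A₁', f.A₁'_A₁, Matrix.one_mul,
    Matrix.mul_assoc, f.B₁_B₁', Matrix.mul_one]

lemma isUnit_block_self : IsUnit (f.block W₀) := by
  rw [f.block_self]; exact isUnit_one

lemma surjective_fderiv_schur : Function.Surjective (fderiv ℝ f.schur W₀) := by
  intro Z
  let j : Matrix (Fin (p - r)) (Fin (q - r)) ℝ → Matrix (Fin p) (Fin q) ℝ :=
    fun Z => W₀ + f.A₁ * Z * f.B₁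
  have hj : ContDiff ℝ ∞ j := by
    rw [← contDiffOn_univ]
    exact contDiffOn_const.add
      ((contDiffOn_const.matrix_mul contDiffOn_id).matrix_mul contDiffOn_const)
  have hj0 : j 0 = W₀ := by simp [j]
  have h1 : DifferentiableAt ℝ f.schur (j 0) := by
    rw [hj0]
    exact ((f.contDiffOn_schur).contDiffAt
      (f.isOpen_isUnit_block.mem_nhds f.isUnit_block_self)).differentiableAt (by simp)
  have h2 : DifferentiableAt ℝ j 0 := hj.contDiffAt.differentiableAt (by simp)
  have h3 := h1.hasFDerivAt.comp 0 h2.hasFDerivAt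
  have h4 : f.schur ∘ j = id := funext f.schur_add
  rw [h4, hj0] at h3
  have h5 := h3.unique (hasFDerivAt_id 0)
  exact ⟨fderiv ℝ j 0 Z, DFunLike.congr_fun h5 Z⟩

end RankFrame

lemma mul_eq_rank_dim_add {p q r : ℕ} (hp : r ≤ p) (hq : r ≤ q) :
    p * q = r * (q + p - r) + (p - r) * (q - r) := by
  obtain ⟨a, rfl⟩ := Nat.exists_eq_add_of_le hp
  obtain ⟨b, rfl⟩ := Nat.exists_eq_add_of_le hq
  have : r + b + (r + a) - r = r + a + b := by omega
  rw [this]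
  simp only [Nat.add_sub_cancel_left]
  ring

theorem isEmbeddedSubmanifold_setOf_rank_eq {p q r : ℕ} (hp : r ≤ p) (hq : r ≤ q) :
    IsEmbeddedSubmanifold (r * (q + p - r)) {W : Matrix (Fin p) (Fin q) ℝ | W.rank = r} := by
  refine isEmbeddedSubmanifold_of_surjective_fderiv
    (F := Matrix (Fin (p - r)) (Fin (q - r)) ℝ) (m := (p - r) * (q - r)) ?_ ?_ ?_
  · rw [Module.finrank_matrix]
    simpa using mul_eq_rank_dim_add hp hq
  · rw [Module.finrank_matrix]; simp
  · intro W hW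
    obtain ⟨f⟩ := nonempty_rankFrame hW
    refine ⟨f.schur, _, f.isOpen_isUnit_block, f.isUnit_block_self, f.contDiffOn_schur,
      f.surjective_fderiv_schur, fun V hV => ?_⟩
    rw [(f.rank_eq_iff_schur_eq_zero f.isUnit_block_self).1 hW]
    exact f.rank_eq_iff_schur_eq_zero hV

theorem isOpen_setOf_le_rank {p q : ℕ} (r : ℕ) :
    IsOpen {W : Matrix (Fin p) (Fin q) ℝ | r ≤ W.rank} := by
  -- Near a matrix of rank `s ≥ r` the `s × s` block of a frame stays invertible.
  rw [isOpen_iff_mem_nhds]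
  intro W hW
  obtain ⟨f⟩ := nonempty_rankFrame (W := W) rfl
  filter_upwards [f.isOpen_isUnit_block.mem_nhds f.isUnit_block_self] with V hV
  exact le_trans hW (f.rank_ge_of_isUnit_block hV)

/-! ### The matrix multiplication map of a linear network -/

lemma finrank_netParams (d : ℕ → ℕ) (h : ℕ) :
    Module.finrank ℝ (NetParams d h) = paramDim d h := by
  simp only [NetParams, paramDim, Module.finrank_pi_fintype, Module.finrank_matrix,
    Module.finrank_self, Fintype.card_fin, mul_one, Finset.sum_range]
  exact Finset.sum_congr rfl fun i _ => mul_comm _ _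

lemma minWidth_le (d : ℕ → ℕ) {h i : ℕ} (hi : i ≤ h) : minWidth d h ≤ d i :=
  Finset.inf'_le d (Finset.mem_range.2 (Nat.lt_succ_of_le hi))

lemma contDiff_layer (d : ℕ → ℕ) (h : ℕ) (i : Fin h) :
    ContDiff ℝ ∞ fun θ : NetParams d h => θ i :=
  contDiff_pi.1 contDiff_id i

theorem contDiff_mulMap (d : ℕ → ℕ) (h : ℕ) : ContDiff ℝ ∞ (mulMap d h) := by
  induction h with
  | zero => exact contDiff_const
  | succ h ih =>
    rw [← contDiffOn_univ]
    refine ContDiffOn.matrix_mul (contDiff_layer d _ _).contDiffOn ?_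
    exact (ih.comp (contDiff_pi.2 fun i =>
      contDiff_layer d (h + 1) ⟨i.val, Nat.lt_add_right 1 i.isLt⟩)).contDiffOn

lemma rank_mulMap_le (d : ℕ → ℕ) {h : ℕ} (θ : NetParams d h) {i : ℕ} (hi : i ≤ h) :
    (mulMap d h θ).rank ≤ d i := by
  induction h with
  | zero =>
    obtain rfl : i = 0 := Nat.le_zero.1 hi
    exact (Matrix.rank_le_card_height _).trans (by simp)
  | succ h ih =>
    rcases Nat.le_succ_iff.1 hi with hi | rfl
    · exact (Matrix.rank_mul_le_right _ _).trans (ih _ hi)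
    · exact (Matrix.rank_le_card_height _).trans (by simp)

lemma rank_mulMap_le_minWidth (d : ℕ → ℕ) {h : ℕ} (θ : NetParams d h) :
    (mulMap d h θ).rank ≤ minWidth d h :=
  Finset.le_inf' _ _ fun _ hi => rank_mulMap_le d θ (Nat.le_of_lt_succ (Finset.mem_range.1 hi))

/-- A matrix of rank at most `k` factors through `ℝᵏ` without loss of rank. -/
lemma Matrix.exists_mul_eq_of_rank_le {p q k : ℕ} (W : Matrix (Fin p) (Fin q) ℝ)
    (hW : W.rank ≤ k) :
    ∃ (A : Matrix (Fin p) (Fin k) ℝ) (B : Matrix (Fin k) (Fin q) ℝ),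
      W = A * B ∧ B.rank ≤ W.rank := by
  obtain ⟨A, -, B, -, -, -, hAB⟩ := W.exists_rank_factorization
  let J : Matrix (Fin k) (Fin W.rank) ℝ := (1 : Matrix (Fin k) (Fin k) ℝ).submatrix id
    (Fin.castLE hW)
  have hJ : Jᵀ * J = 1 := by
    simp only [J, Matrix.transpose_submatrix, Matrix.transpose_one]
    rw [← Matrix.submatrix_mul _ _ _ id _ Function.bijective_id, Matrix.mul_one,
      Matrix.submatrix_one _ (Fin.castLE_injective hW)]
  refine ⟨A * Jᵀ, J * B, ?_, ?_⟩
  · rw [Matrix.mul_assoc, ← Matrix.mul_assoc Jᵀ, hJ, Matrix.one_mul]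
    exact hAB
  · exact (Matrix.rank_mul_le_right _ _).trans ((Matrix.rank_le_card_height _).trans (by simp))

/-- The network reaches each matrix whose rank does not exceed any of the widths. There has to be a
layer, as the empty product is the identity. -/
theorem exists_mulMap_eq (d : ℕ → ℕ) {h : ℕ} (hh : 0 < h) (W : Matrix (Fin (d h)) (Fin (d 0)) ℝ)
    (hW : W.rank ≤ minWidth d h) : ∃ θ, mulMap d h θ = W := by
  replace hW : ∀ i ≤ h, W.rank ≤ d i := fun i hi => hW.trans (minWidth_le d hi)
  induction h, hh using Nat.le_induction with
  | base =>
    refine ⟨Fin.cons (α := fun i : Fin 1 => Matrix (Fin (d (i.val + 1))) (Fin (d i.val)) ℝ) W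
      (fun i => i.elim0), ?_⟩
    exact Matrix.mul_one W
  | succ h hh ih =>
    obtain ⟨A, B, hAB, hB⟩ := W.exists_mul_eq_of_rank_le (hW h h.le_succ)
    obtain ⟨θ, hθ⟩ := ih B fun i hi => hB.trans (hW i (hi.trans h.le_succ))
    let θ' : NetParams d (h + 1) :=
      Fin.snoc (α := fun i : Fin (h + 1) => Matrix (Fin (d (i.val + 1))) (Fin (d i.val)) ℝ) θ A
    have h1 : θ' ⟨h, h.lt_add_one⟩ = A :=
      Fin.snoc_last (α := fun i : Fin (h + 1) => Matrix (Fin (d (i.val + 1))) (Fin (d i.val)) ℝ) _ _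
    have h2 : (fun i : Fin h => θ' ⟨i.val, Nat.lt_add_right 1 i.isLt⟩) = θ := funext fun i =>
      Fin.snoc_castSucc
        (α := fun i : Fin (h + 1) => Matrix (Fin (d (i.val + 1))) (Fin (d i.val)) ℝ) A θ i
    refine ⟨θ', ?_⟩
    rw [mulMap, h1, h2, hθ, ← hAB]

lemma exists_mulMap_add_smul_eq_left (d : ℕ → ℕ) {h : ℕ} (hh : 0 < h) (θ : NetParams d h)
    (P : Matrix (Fin (d h)) (Fin (d h)) ℝ) :
    ∃ v : NetParams d h, ∀ t : ℝ,
      mulMap d h (θ + t • v) = mulMap d h θ + t • (P * mulMap d h θ) := by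
  obtain ⟨h, rfl⟩ := Nat.exists_eq_succ_of_ne_zero hh.ne'
  let i₀ : Fin (h + 1) := ⟨h, h.lt_add_one⟩
  let v : NetParams d (h + 1) := Pi.single
    (M := fun i : Fin (h + 1) => Matrix (Fin (d (i.val + 1))) (Fin (d i.val)) ℝ) i₀ (P * θ i₀)
  refine ⟨v, fun t => ?_⟩
  have h1 : (fun i : Fin h => (θ + t • v) ⟨i.val, Nat.lt_add_right 1 i.isLt⟩) =
      fun i : Fin h => θ ⟨i.val, Nat.lt_add_right 1 i.isLt⟩ := by
    funext i
    have h0 : (⟨i.val, Nat.lt_add_right 1 i.isLt⟩ : Fin (h + 1)) ≠ i₀ := by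
      simp [i₀, i.isLt.ne]
    have h2 : v ⟨i.val, Nat.lt_add_right 1 i.isLt⟩ = 0 := Pi.single_eq_of_ne h0 _
    rw [Pi.add_apply, Pi.smul_apply, h2, smul_zero, add_zero]
  have h2 : v i₀ = P * θ i₀ := Pi.single_eq_same _ _
  change (θ i₀ + t • v i₀) * mulMap d h _ =
    θ i₀ * mulMap d h _ + t • (P * (θ i₀ * mulMap d h _))
  rw [h1, h2, Matrix.add_mul, Matrix.smul_mul, Matrix.mul_assoc]

lemma exists_mulMap_add_smul_eq_right (d : ℕ → ℕ) {h : ℕ} (hh : 0 < h) (θ : NetParams d h)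
    (Q : Matrix (Fin (d 0)) (Fin (d 0)) ℝ) :
    ∃ v : NetParams d h, ∀ t : ℝ,
      mulMap d h (θ + t • v) = mulMap d h θ + t • (mulMap d h θ * Q) := by
  refine ⟨Pi.single (M := fun i : Fin h => Matrix (Fin (d (i.val + 1))) (Fin (d i.val)) ℝ)
    ⟨0, hh⟩ (θ ⟨0, hh⟩ * Q), fun t => ?_⟩
  induction h, hh using Nat.le_induction with
  | base =>
    let A : Matrix (Fin (d 1)) (Fin (d 0)) ℝ := θ 0
    let V : Matrix (Fin (d 1)) (Fin (d 0)) ℝ := Pi.single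
      (M := fun i : Fin 1 => Matrix (Fin (d (i.val + 1))) (Fin (d i.val)) ℝ) 0 (A * Q) 0
    have h1 : V = A * Q := Pi.single_eq_same _ _
    change (A + t • V) * (1 : Matrix (Fin (d 0)) (Fin (d 0)) ℝ) =
      A * (1 : Matrix (Fin (d 0)) (Fin (d 0)) ℝ) +
        t • (A * (1 : Matrix (Fin (d 0)) (Fin (d 0)) ℝ) * Q)
    rw [h1, Matrix.mul_one, Matrix.mul_one]
  | succ h hh ih =>
    let v : NetParams d (h + 1) := Pi.single
      (M := fun i : Fin (h + 1) => Matrix (Fin (d (i.val + 1))) (Fin (d i.val)) ℝ)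
      ⟨0, h.succ_pos⟩ (θ ⟨0, h.succ_pos⟩ * Q)
    have h1 : v ⟨h, h.lt_add_one⟩ = 0 := Pi.single_eq_of_ne (by simp; omega) _
    have h2 : (fun i : Fin h => v ⟨i.val, Nat.lt_add_right 1 i.isLt⟩) = Pi.single
        (M := fun i : Fin h => Matrix (Fin (d (i.val + 1))) (Fin (d i.val)) ℝ)
        ⟨0, hh⟩ (θ ⟨0, h.succ_pos⟩ * Q) := by
      funext i
      by_cases hi : i = ⟨0, hh⟩
      · subst hi
        rw [Pi.single_eq_same]
        exact Pi.single_eq_same _ _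
      · rw [Pi.single_eq_of_ne hi]
        exact Pi.single_eq_of_ne (by simpa [Fin.ext_iff] using hi) _
    have h3 := ih fun i => θ ⟨i.val, Nat.lt_add_right 1 i.isLt⟩
    rw [← h2] at h3
    change (θ ⟨h, h.lt_add_one⟩ + t • v ⟨h, h.lt_add_one⟩) * mulMap d h _ =
      θ ⟨h, h.lt_add_one⟩ * mulMap d h _ + t • (θ ⟨h, h.lt_add_one⟩ * mulMap d h _ * Q)
    rw [h1, smul_zero, add_zero, Matrix.mul_assoc, ← Matrix.mul_smul, ← Matrix.mul_add]
    exact congrArg _ h3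

lemma fderiv_apply_eq_of_forall_add_smul {E F : Type*} [NormedAddCommGroup E] [NormedSpace ℝ E]
    [NormedAddCommGroup F] [NormedSpace ℝ F] {f : E → F} {x v : E} {w : F}
    (hf : DifferentiableAt ℝ f x) (h : ∀ t : ℝ, f (x + t • v) = f x + t • w) :
    fderiv ℝ f x v = w := by
  have h1 : HasDerivAt (fun t : ℝ => f (x + t • v)) (fderiv ℝ f x v) 0 :=
    hf.hasFDerivAt.hasLineDerivAt v
  have h2 : HasDerivAt (fun t : ℝ => f (x + t • v)) w 0 := by
    simp only [h]
    simpa using ((hasDerivAt_id (0 : ℝ)).smul_const w).const_add (f x)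
  exact h1.unique h2

lemma differentiableAt_mulMap (d : ℕ → ℕ) {h : ℕ} (θ : NetParams d h) :
    DifferentiableAt ℝ (mulMap d h) θ :=
  (contDiff_mulMap d h).contDiffAt.differentiableAt (by simp)

/-- Changing the last layer `W_h` and the first layer `W_1` of the network produces all directions
tangent to the orbit of the product under row and column operations. -/
theorem mul_add_mul_mem_range_fderiv_mulMap (d : ℕ → ℕ) {h : ℕ} (hh : 0 < h) (θ : NetParams d h)
    (P : Matrix (Fin (d h)) (Fin (d h)) ℝ) (Q : Matrix (Fin (d 0)) (Fin (d 0)) ℝ) :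
    P * mulMap d h θ + mulMap d h θ * Q ∈ (fderiv ℝ (mulMap d h) θ).range := by
  obtain ⟨v, hv⟩ := exists_mulMap_add_smul_eq_left d hh θ P
  obtain ⟨w, hw⟩ := exists_mulMap_add_smul_eq_right d hh θ Q
  exact add_mem ⟨v, fderiv_apply_eq_of_forall_add_smul (differentiableAt_mulMap d θ) hv⟩
    ⟨w, fderiv_apply_eq_of_forall_add_smul (differentiableAt_mulMap d θ) hw⟩

section RankStratum

variable {d : ℕ → ℕ} {h : ℕ} {θ : NetParams d h}

lemma surjective_rowsCols_comp_fderiv_mulMap {r : ℕ} (hh : 0 < h)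
    (f : RankFrame (mulMap d h θ) r) :
    Function.Surjective fun v => f.rowsCols (fderiv ℝ (mulMap d h) θ v) := by
  intro z
  obtain ⟨P, Q, hPQ⟩ := f.exists_rowsCols_eq z
  obtain ⟨v, hv⟩ := mul_add_mul_mem_range_fderiv_mulMap d hh θ P Q
  exact ⟨v, by rw [← hPQ, ← hv]; rfl⟩

lemma isOpen_setOf_rank_mulMap_eq (d : ℕ → ℕ) (h : ℕ) :
    IsOpen {θ | (mulMap d h θ).rank = minWidth d h} := by
  have : {θ | (mulMap d h θ).rank = minWidth d h} =
      mulMap d h ⁻¹' {W | minWidth d h ≤ W.rank} :=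
    Set.ext fun θ => ⟨fun h => h.ge, fun h => le_antisymm (rank_mulMap_le_minWidth d θ) h⟩
  rw [this]
  exact (isOpen_setOf_le_rank _).preimage (contDiff_mulMap d h).continuous

lemma finrank_rowsCols_codomain {p q r : ℕ} (hp : r ≤ p) :
    Module.finrank ℝ (Matrix (Fin r) (Fin q) ℝ × Matrix (Fin (p - r)) (Fin r) ℝ) =
      r * (q + p - r) := by
  rw [Module.finrank_prod, Module.finrank_matrix, Module.finrank_matrix, Nat.add_sub_assoc hp]
  simp
  ring

/-- Where the product has the largest possible rank `r`, the range of the differential is the tangent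
space of the matrices of rank `r`. -/
theorem finrank_range_fderiv_mulMap (hh : 0 < h) (hθ : (mulMap d h θ).rank = minWidth d h) :
    Module.finrank ℝ (fderiv ℝ (mulMap d h) θ).range =
      minWidth d h * (d 0 + d h - minWidth d h) := by
  obtain ⟨f⟩ := nonempty_rankFrame hθ
  have hp : minWidth d h ≤ d h := minWidth_le d le_rfl
  have hq : minWidth d h ≤ d 0 := minWidth_le d h.zero_le
  set D := fderiv ℝ (mulMap d h) θ with hD
  apply le_antisymm
  · -- The Schur complement vanishes on the image of a neighbourhood of `θ`, so its
    -- differential vanishes on the range of `D`.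
    have hs : DifferentiableAt ℝ f.schur (mulMap d h θ) :=
      (f.contDiffOn_schur.contDiffAt
        (f.isOpen_isUnit_block.mem_nhds f.isUnit_block_self)).differentiableAt (by simp)
    have hzero : (fderiv ℝ f.schur (mulMap d h θ)).comp D = 0 := by
      have h1 := hs.hasFDerivAt.comp θ (differentiableAt_mulMap d θ).hasFDerivAt
      have h2 : f.schur ∘ mulMap d h =ᶠ[nhds θ] fun _ => 0 := by
        filter_upwards [(isOpen_setOf_rank_mulMap_eq d h).mem_nhds hθ,
          (f.isOpen_isUnit_block.preimage (contDiff_mulMap d h).continuous).mem_nhds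
            f.isUnit_block_self] with η h3 h4
        exact (f.rank_eq_iff_schur_eq_zero h4).1 h3
      exact h1.unique ((hasFDerivAt_const 0 θ).congr_of_eventuallyEq h2)
    have hle : D.range ≤ (fderiv ℝ f.schur (mulMap d h θ)).ker := by
      rintro _ ⟨v, rfl⟩
      exact DFunLike.congr_fun hzero v
    refine (Submodule.finrank_mono hle).trans ?_
    have h1 := (fderiv ℝ f.schur (mulMap d h θ)).toLinearMap.finrank_range_add_finrank_ker
    have h2 : (fderiv ℝ f.schur (mulMap d h θ)).toLinearMap.range = ⊤ :=
      LinearMap.range_eq_top.2 f.surjective_fderiv_schur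
    rw [h2, finrank_top, Module.finrank_matrix, Module.finrank_matrix] at h1
    simp only [Fintype.card_fin, Module.finrank_self, mul_one,
      mul_eq_rank_dim_add hp hq] at h1
    omega
  · rw [← finrank_rowsCols_codomain hp]
    have h1 : D.range.map f.rowsCols = ⊤ := by
      rw [eq_top_iff]
      rintro z -
      obtain ⟨v, hv⟩ := surjective_rowsCols_comp_fderiv_mulMap hh f z
      exact ⟨D v, ⟨v, rfl⟩, hv⟩
    rw [← finrank_top, ← h1]
    exact Submodule.finrank_map_le _ _

theorem rank_dim_le_paramDim (hh : 0 < h) (hθ : (mulMap d h θ).rank = minWidth d h) :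
    minWidth d h * (d 0 + d h - minWidth d h) ≤ paramDim d h := by
  rw [← finrank_range_fderiv_mulMap hh hθ, ← finrank_netParams]
  exact LinearMap.finrank_range_le _

/-- Within the open set where the product has rank `r`, the fibre is locally the level set of the
submersion `rowsCols ∘ mulMap`. -/
theorem isEmbeddedSubmanifold_preimage_mulMap (hh : 0 < h)
    {W : Matrix (Fin (d h)) (Fin (d 0)) ℝ} (hW : W.rank = minWidth d h) :
    IsEmbeddedSubmanifold (paramDim d h - minWidth d h * (d 0 + d h - minWidth d h))
      (mulMap d h ⁻¹' {W}) := by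
  obtain ⟨θ₀, hθ₀⟩ := exists_mulMap_eq d hh W hW.le
  have hp : minWidth d h ≤ d h := minWidth_le d le_rfl
  refine isEmbeddedSubmanifold_of_surjective_fderiv
    (F := Matrix (Fin (minWidth d h)) (Fin (d 0)) ℝ ×
      Matrix (Fin (d h - minWidth d h)) (Fin (minWidth d h)) ℝ)
    (m := minWidth d h * (d 0 + d h - minWidth d h)) ?_ (finrank_rowsCols_codomain hp) ?_
  · rw [finrank_netParams, Nat.sub_add_cancel (rank_dim_le_paramDim hh (hθ₀ ▸ hW))]
  · intro θ hθ
    have hθW : mulMap d h θ = W := hθ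
    have hθr : (mulMap d h θ).rank = minWidth d h := hθW ▸ hW
    obtain ⟨f⟩ := nonempty_rankFrame hθr
    have hg : (fun η => f.rowsCols (mulMap d h η)) =
        f.rowsCols.toContinuousLinearMap ∘ mulMap d h := rfl
    refine ⟨fun η => f.rowsCols (mulMap d h η),
      {η | (mulMap d h η).rank = minWidth d h} ∩ mulMap d h ⁻¹' {V | IsUnit (f.block V)},
      (isOpen_setOf_rank_mulMap_eq d h).inter
        (f.isOpen_isUnit_block.preimage (contDiff_mulMap d h).continuous),
      ⟨hθr, f.isUnit_block_self⟩, ?_, ?_, ?_⟩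
    · rw [hg]
      exact (f.rowsCols.toContinuousLinearMap.contDiff.comp (contDiff_mulMap d h)).contDiffOn
    · rw [hg, (f.rowsCols.toContinuousLinearMap.hasFDerivAt.comp θ
        (differentiableAt_mulMap d θ).hasFDerivAt).fderiv]
      exact surjective_rowsCols_comp_fderiv_mulMap hh f
    · rintro η ⟨h1, h2⟩
      constructor
      · intro h3
        have h3' : mulMap d h η = W := h3
        simp only [h3', hθW]
      · intro h3
        exact (f.eq_of_rowsCols_eq h2 h1 hθr h3).trans hθW

end RankStratum

/-! ### Best approximation by matrices of given rank -/

section FrobeniusNorm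

variable {m n : Type*} [Fintype m] [Fintype n]

lemma Matrix.frobenius_norm_sq_eq_sum (M : Matrix m n ℝ) : ‖M‖ ^ 2 = ∑ i, ∑ j, M i j ^ 2 := by
  have h : 0 ≤ ∑ i, ∑ j, ‖M i j‖ ^ (2 : ℝ) := by positivity
  rw [Matrix.frobenius_norm_def, ← Real.sqrt_eq_rpow, Real.sq_sqrt h]
  simp

lemma Matrix.frobenius_norm_sq_eq_trace (M : Matrix m n ℝ) : ‖M‖ ^ 2 = (Mᵀ * M).trace := by
  rw [Matrix.frobenius_norm_sq_eq_sum, Matrix.trace, Finset.sum_comm]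
  simp [Matrix.mul_apply, sq]

lemma Matrix.frobenius_norm_mul_orthogonal [DecidableEq n] (M : Matrix m n ℝ)
    {U : Matrix n n ℝ} (hU : U * Uᵀ = 1) : ‖M * U‖ = ‖M‖ := by
  have h : ‖M * U‖ ^ 2 = ‖M‖ ^ 2 := by
    rw [Matrix.frobenius_norm_sq_eq_trace, Matrix.frobenius_norm_sq_eq_trace, Matrix.transpose_mul,
      Matrix.mul_assoc, Matrix.trace_mul_comm, Matrix.mul_assoc, Matrix.mul_assoc, hU,
      Matrix.mul_one]
  exact (sq_eq_sq₀ (norm_nonneg _) (norm_nonneg _)).1 h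

/-- The Pythagorean theorem for the splitting of the row space by an orthogonal projection. -/
lemma Matrix.frobenius_norm_sq_add_of_isProj [DecidableEq n] (M : Matrix m n ℝ) {P : Matrix n n ℝ}
    (hPt : Pᵀ = P) (hP : P * P = P) : ‖M‖ ^ 2 = ‖M * P‖ ^ 2 + ‖M * (1 - P)‖ ^ 2 := by
  have h : ∀ Q : Matrix n n ℝ, Qᵀ = Q → Q * Q = Q → ‖M * Q‖ ^ 2 = (Mᵀ * M * Q).trace := by
    intro Q hQt hQ
    rw [Matrix.frobenius_norm_sq_eq_trace, Matrix.transpose_mul, hQt, Matrix.mul_assoc,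
      Matrix.trace_mul_comm, Matrix.mul_assoc, Matrix.mul_assoc, hQ, Matrix.mul_assoc]
  rw [h P hPt hP, h (1 - P) (by simp [hPt]) (by simp [Matrix.sub_mul, Matrix.mul_sub, hP]),
    Matrix.frobenius_norm_sq_eq_trace, ← Matrix.trace_add, ← Matrix.mul_add, add_sub_cancel,
    Matrix.mul_one]

end FrobeniusNorm

lemma Matrix.isUnit_of_rank_eq_card {n K : Type*} [Fintype n] [DecidableEq n] [Field K]
    {M : Matrix n n K} (h : M.rank = Fintype.card n) : IsUnit M := by
  rw [← Matrix.mulVec_surjective_iff_isUnit]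
  have h1 : LinearMap.range M.mulVecLin = ⊤ := by
    apply Submodule.eq_top_of_finrank_eq
    rw [Module.finrank_fintype_fun_eq_card, ← h, Matrix.rank]
  exact LinearMap.range_eq_top.1 h1

/-- The orthogonal projection onto the kernel of a matrix. -/
lemma Matrix.exists_orthogonal_projection_ker {p q : ℕ} (Z : Matrix (Fin p) (Fin q) ℝ) :
    ∃ P : Matrix (Fin q) (Fin q) ℝ, Pᵀ = P ∧ P * P = P ∧ Z * P = 0 ∧
      P.trace = q - Z.rank := by
  obtain ⟨A, -, B, B', -, hB, hAB⟩ := Z.exists_rank_factorization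
  have hr : B.rank = Z.rank := by
    refine le_antisymm ((Matrix.rank_le_card_height _).trans (by simp)) ?_
    calc Z.rank = (B * B').rank := by rw [hB, Matrix.rank_one, Fintype.card_fin]
      _ ≤ B.rank := Matrix.rank_mul_le_left _ _
  have hG : IsUnit (B * Bᵀ).det := by
    rw [← Matrix.isUnit_iff_isUnit_det]
    refine Matrix.isUnit_of_rank_eq_card ?_
    rw [Matrix.rank_self_mul_transpose, hr, Fintype.card_fin]
  have hGt : (B * Bᵀ)⁻¹ᵀ = (B * Bᵀ)⁻¹ := by
    rw [Matrix.transpose_nonsing_inv, Matrix.transpose_mul, Matrix.transpose_transpose]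
  have hBP : B * (Bᵀ * ((B * Bᵀ)⁻¹ * B)) = B := by
    rw [← Matrix.mul_assoc, ← Matrix.mul_assoc, Matrix.mul_nonsing_inv _ hG, Matrix.one_mul]
  refine ⟨1 - Bᵀ * ((B * Bᵀ)⁻¹ * B), ?_, ?_, ?_, ?_⟩
  · simp only [Matrix.transpose_sub, Matrix.transpose_one, Matrix.transpose_mul, hGt,
      Matrix.transpose_transpose, Matrix.mul_assoc]
  · have h : Bᵀ * ((B * Bᵀ)⁻¹ * B) * (Bᵀ * ((B * Bᵀ)⁻¹ * B)) = Bᵀ * ((B * Bᵀ)⁻¹ * B) := by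
      rw [Matrix.mul_assoc, Matrix.mul_assoc, hBP]
    rw [Matrix.mul_sub, Matrix.sub_mul, Matrix.sub_mul, h]
    simp
  · have hZ : A * B * (1 - Bᵀ * ((B * Bᵀ)⁻¹ * B)) = 0 := by
      rw [Matrix.mul_assoc, Matrix.mul_sub, hBP, Matrix.mul_one, sub_self, Matrix.mul_zero]
    rwa [← hAB] at hZ
  · rw [Matrix.trace_sub, Matrix.trace_mul_comm, Matrix.mul_assoc, Matrix.nonsing_inv_mul _ hG,
      Matrix.trace_one, Matrix.trace_one, Fintype.card_fin, Fintype.card_fin]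

section DiagonalGram

variable {p q : ℕ} {A : Matrix (Fin p) (Fin q) ℝ} {lam : Fin q → ℝ} {s : Finset (Fin q)} {c : ℝ}

/-- The coordinate projection onto the span of the basis vectors with index in `s`. -/
noncomputable def coordProj (s : Finset (Fin q)) : Matrix (Fin q) (Fin q) ℝ :=
  Matrix.diagonal fun i => if i ∈ s then 1 else 0

lemma transpose_coordProj (s : Finset (Fin q)) : (coordProj s)ᵀ = coordProj s :=
  Matrix.diagonal_transpose _

lemma frobenius_norm_sq_mul_proj {P : Matrix (Fin q) (Fin q) ℝ} (hA : Aᵀ * A = Matrix.diagonal lam)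
    (hPt : Pᵀ = P) (hP : P * P = P) : ‖A * P‖ ^ 2 = ∑ i, lam i * P i i := by
  rw [Matrix.frobenius_norm_sq_eq_trace, Matrix.transpose_mul, hPt, Matrix.mul_assoc,
    Matrix.trace_mul_comm, Matrix.mul_assoc, Matrix.mul_assoc, hP, ← Matrix.mul_assoc, hA]
  simp [Matrix.trace, Matrix.diagonal_mul]

lemma norm_sub_mul_coordProj_sq (hA : Aᵀ * A = Matrix.diagonal lam) :
    ‖A - A * coordProj s‖ ^ 2 = ∑ i, lam i * (if i ∈ s then 0 else 1) := by
  have h1 : A - A * coordProj s = A * (1 - coordProj s) := by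
    rw [Matrix.mul_sub, Matrix.mul_one]
  have h2 : (1 - coordProj s : Matrix (Fin q) (Fin q) ℝ) =
      Matrix.diagonal fun i => if i ∈ s then 0 else 1 := by
    rw [coordProj, ← Matrix.diagonal_one]
    refine (Matrix.diagonal_sub _ _).trans (congrArg _ ?_)
    funext i
    split_ifs <;> simp
  rw [h1, h2, frobenius_norm_sq_mul_proj hA (Matrix.diagonal_transpose _)]
  · simp
  · rw [Matrix.diagonal_mul_diagonal]
    congr 1
    funext i
    split_ifs <;> simp

lemma rank_mul_coordProj (hA : Aᵀ * A = Matrix.diagonal lam) (hs : ∀ i ∈ s, lam i ≠ 0) :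
    (A * coordProj s).rank = s.card := by
  rw [← Matrix.rank_transpose_mul_self, Matrix.transpose_mul, transpose_coordProj,
    Matrix.mul_assoc, ← Matrix.mul_assoc Aᵀ, hA, coordProj, Matrix.diagonal_mul_diagonal,
    Matrix.diagonal_mul_diagonal, Matrix.rank_diagonal, ← Fintype.card_coe]
  refine Fintype.card_congr (Equiv.subtypeEquivRight fun i => ?_)
  by_cases hi : i ∈ s <;> simp [hi, hs]

/-- The Eckart–Young theorem with uniqueness, for a matrix with orthogonal columns of squared
lengths `lam i`. With `P` the orthogonal projection onto the kernel of the competitor `Z`, one has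
`‖A - Z‖² ≥ ‖A * P‖² = ∑ lam i * P i i`, where the weights `P i i ∈ [0, 1]` have sum at least
`q - card s`; such a sum is smallest exactly when the weight is spread over the indices outside
`s`. -/
theorem norm_sub_mul_coordProj_lt (hA : Aᵀ * A = Matrix.diagonal lam) (hc : 0 < c)
    (hs : ∀ i ∈ s, c < lam i) (hs' : ∀ i ∉ s, lam i < c) {Z : Matrix (Fin p) (Fin q) ℝ}
    (hZ : Z.rank ≤ s.card) (hne : Z ≠ A * coordProj s) :
    ‖A - A * coordProj s‖ < ‖A - Z‖ := by
  obtain ⟨P, hPt, hP, hZP, htr⟩ := Z.exists_orthogonal_projection_ker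
  have hPii : ∀ i, P i i = ∑ j, P i j ^ 2 := by
    intro i
    have h1 : (P * Pᵀ) i i = P i i := by rw [hPt, hP]
    rw [← h1, Matrix.mul_apply]
    simp [sq]
  have hP0 : ∀ i, 0 ≤ P i i := fun i => by rw [hPii]; positivity
  have hP1 : ∀ i, P i i ≤ 1 := by
    intro i
    have h1 : P i i ^ 2 ≤ P i i := by
      conv_rhs => rw [hPii]
      exact Finset.single_le_sum (f := fun j => P i j ^ 2) (fun j _ => sq_nonneg _)
        (Finset.mem_univ i)
    by_contra! h2
    nlinarith
  have hsplit : ‖A - Z‖ ^ 2 = ∑ i, lam i * P i i + ‖(A - Z) * (1 - P)‖ ^ 2 := by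
    rw [Matrix.frobenius_norm_sq_add_of_isProj (A - Z) hPt hP, Matrix.sub_mul A Z P, hZP, sub_zero,
      frobenius_norm_sq_mul_proj hA hPt hP]
  -- the loss against the optimal weights, as a sum of nonnegative terms
  let δ : Fin q → ℝ := fun i => if i ∈ s then (lam i - c) * P i i else (c - lam i) * (1 - P i i)
  have hδ : ∀ i, 0 ≤ δ i := by
    intro i
    by_cases hi : i ∈ s
    · simp only [δ, hi, if_true]
      exact mul_nonneg (sub_nonneg.2 (hs i hi).le) (hP0 i)
    · simp only [δ, hi, if_false]
      exact mul_nonneg (sub_nonneg.2 (hs' i hi).le) (sub_nonneg.2 (hP1 i))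
  have hcard : ∑ i : Fin q, (if i ∈ s then (0 : ℝ) else 1) = q - s.card := by
    have h1 : ∀ i : Fin q, (if i ∈ s then (0 : ℝ) else 1) = 1 - if i ∈ s then 1 else 0 := by
      intro i; split_ifs <;> simp
    simp only [h1, Finset.sum_sub_distrib]
    simp
  have hsum : ∑ i, lam i * P i i = ∑ i, lam i * (if i ∈ s then 0 else 1) + ∑ i, δ i +
      c * (s.card - Z.rank) := by
    have h1 : ∀ i, lam i * P i i = lam i * (if i ∈ s then 0 else 1) + δ i +
        c * (P i i - if i ∈ s then 0 else 1) := by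
      intro i
      by_cases hi : i ∈ s <;> simp only [δ, hi, if_true, if_false] <;> ring
    have h2 : ∑ i, P i i = q - Z.rank := htr
    rw [Finset.sum_congr rfl fun i _ => h1 i, Finset.sum_add_distrib, Finset.sum_add_distrib,
      ← Finset.mul_sum, Finset.sum_sub_distrib, hcard, h2]
    ring
  have hrank : (0 : ℝ) ≤ c * (s.card - Z.rank) :=
    mul_nonneg hc.le (sub_nonneg.2 (by exact_mod_cast hZ))
  have hδs : 0 ≤ ∑ i, δ i := Finset.sum_nonneg fun i _ => hδ i
  have hsq : ‖A - A * coordProj s‖ ^ 2 < ‖A - Z‖ ^ 2 := by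
    by_contra! hle
    rw [norm_sub_mul_coordProj_sq hA, hsplit, hsum] at hle
    have hrest := sq_nonneg ‖(A - Z) * (1 - P)‖
    have h1 : ∑ i, δ i = 0 := by linarith
    have h2 : ‖(A - Z) * (1 - P)‖ ^ 2 = 0 := by linarith
    have h3 : ∀ i, P i i = if i ∈ s then 0 else 1 := by
      intro i
      have h4 := (Finset.sum_eq_zero_iff_of_nonneg fun i _ => hδ i).1 h1 i (Finset.mem_univ i)
      by_cases hi : i ∈ s
      · simp only [δ, hi, if_true, mul_eq_zero] at h4 ⊢
        exact h4.resolve_left (sub_pos.2 (hs i hi)).ne'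
      · simp only [δ, hi, if_false, mul_eq_zero] at h4 ⊢
        linarith [h4.resolve_left (sub_pos.2 (hs' i hi)).ne']
    have h5 : ∀ i j, i ≠ j → P i j = 0 := by
      intro i j hij
      have h6 : P i i ^ 2 + P i j ^ 2 ≤ P i i := by
        conv_rhs => rw [hPii]
        rw [← Finset.sum_pair (f := fun j => P i j ^ 2) hij]
        exact Finset.sum_le_sum_of_subset_of_nonneg (Finset.subset_univ _)
          fun j _ _ => sq_nonneg _
      have h7 : P i i ^ 2 = P i i := by rw [h3]; split_ifs <;> simp
      exact pow_eq_zero_iff two_ne_zero |>.1 (le_antisymm (by linarith) (sq_nonneg _))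
    have h8 : 1 - P = coordProj s := by
      ext i j
      by_cases hij : i = j
      · subst hij
        simp only [Matrix.sub_apply, Matrix.one_apply_eq, coordProj, Matrix.diagonal_apply_eq, h3]
        split_ifs <;> simp
      · simp [coordProj, hij, h5 i j hij]
    have h9 : (A - Z) * (1 - P) = 0 := norm_eq_zero.1 (pow_eq_zero_iff two_ne_zero |>.1 h2)
    apply hne
    rw [Matrix.sub_mul, Matrix.mul_sub Z, hZP, sub_zero, Matrix.mul_one, h8, sub_eq_zero] at h9
    exact h9.symm
  exact lt_of_pow_lt_pow_left₀ 2 (norm_nonneg _) hsq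

end DiagonalGram

/-- The right half of the singular value decomposition: an orthogonal matrix `U` for which the
columns of `W * U` are orthogonal and have the singular values as lengths. -/
theorem exists_orthogonal_gram_eq_diagonal {p q : ℕ} (W : Matrix (Fin p) (Fin q) ℝ) :
    ∃ U : Matrix (Fin q) (Fin q) ℝ, U * Uᵀ = 1 ∧
      (W * U)ᵀ * (W * U) = Matrix.diagonal fun i : Fin q => matSingularValue W i ^ 2 := by
  let T := Matrix.toEuclideanLin W
  have hn : Module.finrank ℝ (EuclideanSpace ℝ (Fin q)) = q := finrank_euclideanSpace_fin
  let hT := T.isSymmetric_adjoint_comp_self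
  let b := hT.eigenvectorBasis hn
  let U : Matrix (Fin q) (Fin q) ℝ := Matrix.of fun i j => b j i
  have hUU : Uᵀ * U = 1 := by
    ext i j
    have h1 := orthonormal_iff_ite.1 b.orthonormal j i
    rw [PiLp.inner_apply] at h1
    rw [Matrix.mul_apply, Matrix.one_apply]
    simpa [U, eq_comm] using h1
  have hWU : ∀ i j, (W * U) i j = T (b j) i := by
    intro i j
    simp [T, U, Matrix.mul_apply, Matrix.toLpLin_apply, Matrix.mulVec, dotProduct]
  refine ⟨U, mul_eq_one_comm.1 hUU, ?_⟩
  ext i j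
  have h1 : inner ℝ (T (b j)) (T (b i)) = if i = j then matSingularValue W i ^ 2 else 0 := by
    have h2 : inner ℝ (T (b j)) (T (b i)) = inner ℝ (b j) ((T.adjoint ∘ₗ T) (b i)) := by
      rw [LinearMap.comp_apply, LinearMap.adjoint_inner_right]
    rw [h2, hT.apply_eigenvectorBasis hn i, inner_smul_right,
      orthonormal_iff_ite.1 b.orthonormal j i, matSingularValue, T.sq_singularValues_fin hn i]
    simp [eq_comm]
  rw [PiLp.inner_apply] at h1
  rw [Matrix.mul_apply, Matrix.diagonal_apply, ← h1]
  simp [hWU]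

/-- The Eckart–Young theorem with uniqueness: if the first `r` singular values of `W` are larger
than the following one, then `W` has a unique best approximation of rank at most `r` in the
Frobenius norm, and the rank of this approximation is `r`. -/
theorem exists_unique_best_rank_approximation {p q r : ℕ} (W : Matrix (Fin p) (Fin q) ℝ)
    (hr : r ≤ q) (hgap : ∀ i < r, matSingularValue W r < matSingularValue W i) :
    ∃ Z₀ : Matrix (Fin p) (Fin q) ℝ, Z₀.rank = r ∧
      ∀ Z : Matrix (Fin p) (Fin q) ℝ, Z.rank ≤ r → Z ≠ Z₀ → ‖W - Z₀‖ < ‖W - Z‖ := by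
  obtain ⟨U, hU, hgram⟩ := exists_orthogonal_gram_eq_diagonal W
  have hU' : Uᵀ * U = 1 := mul_eq_one_comm.1 hU
  have hUunit : IsUnit U.det := (Matrix.isUnit_iff_isUnit_det _).1 (IsUnit.of_mul_eq_one _ hU)
  have hanti : Antitone (matSingularValue W) := LinearMap.singularValues_antitone _
  have hnonneg : ∀ i, 0 ≤ matSingularValue W i := LinearMap.singularValues_nonneg _
  obtain ⟨c, hc, hcr, hcr'⟩ : ∃ c : ℝ, 0 < c ∧ (∀ i < r, c < matSingularValue W i ^ 2) ∧
      ∀ i ≥ r, matSingularValue W i ^ 2 < c := by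
    rcases Nat.eq_zero_or_pos r with rfl | hpos
    · refine ⟨matSingularValue W 0 ^ 2 + 1, by positivity, fun i hi => absurd hi (by simp),
        fun i hi => ?_⟩
      have h1 := pow_le_pow_left₀ (hnonneg i) (hanti hi) 2
      linarith
    · have h1 := pow_lt_pow_left₀ (hgap (r - 1) (by omega)) (hnonneg r) two_ne_zero
      have h0 := sq_nonneg (matSingularValue W r)
      refine ⟨(matSingularValue W (r - 1) ^ 2 + matSingularValue W r ^ 2) / 2, by linarith,
        fun i hi => ?_, fun i hi => ?_⟩
      · have h2 := pow_le_pow_left₀ (hnonneg (r - 1)) (hanti (show i ≤ r - 1 by omega)) 2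
        linarith
      · have h2 := pow_le_pow_left₀ (hnonneg i) (hanti hi) 2
        linarith
  let s : Finset (Fin q) := Finset.univ.filter fun i => i.val < r
  have hmem : ∀ i : Fin q, i ∈ s ↔ i.val < r := fun i => by simp [s]
  have hcard : s.card = r := by
    simp [s, Fin.card_filter_val_lt, hr]
  have hs : ∀ i ∈ s, c < matSingularValue W i ^ 2 := fun i hi => hcr i ((hmem i).1 hi)
  have hs' : ∀ i ∉ s, matSingularValue W i ^ 2 < c := fun i hi =>
    hcr' i (not_lt.1 fun h => hi ((hmem i).2 h))
  refine ⟨W * U * coordProj s * Uᵀ, ?_, fun Z hZ hne => ?_⟩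
  · rw [Matrix.rank_mul_eq_left_of_isUnit_det _ _ (by rwa [Matrix.det_transpose]),
      rank_mul_coordProj hgram fun i hi => (hc.trans (hs i hi)).ne', hcard]
  · have h1 := norm_sub_mul_coordProj_lt hgram hc hs hs' (Z := Z * U)
      (by rwa [hcard, Matrix.rank_mul_eq_left_of_isUnit_det _ _ hUunit]) (fun h => hne (by
        rw [← h, Matrix.mul_assoc, hU, Matrix.mul_one]))
    have h2 : W * U - W * U * coordProj s = (W - W * U * coordProj s * Uᵀ) * U := by
      rw [Matrix.sub_mul, Matrix.mul_assoc _ Uᵀ, hU', Matrix.mul_one]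
    rwa [h2, ← Matrix.sub_mul, Matrix.frobenius_norm_mul_orthogonal _ hU,
      Matrix.frobenius_norm_mul_orthogonal _ hU] at h1

/-! ### The quadratic loss -/

section Whitening

open scoped MatrixOrder

/-- Up to a constant, the quadratic loss is the squared distance of the whitened product
`W (X Xᵀ)^{1/2}` to the whitened target. -/
theorem exists_quadLoss_eq_norm_sub_sq {p q n : ℕ} (X : Matrix (Fin q) (Fin n) ℝ)
    (Y : Matrix (Fin p) (Fin n) ℝ) (hX : (X * Xᵀ).rank = q) :
    ∃ (S : Matrix (Fin q) (Fin q) ℝ) (c : ℝ), IsUnit S.det ∧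
      ∀ W, quadLoss X Y W = ‖whitenedTarget X Y - W * S‖ ^ 2 + c := by
  have hpos : (X * Xᵀ).PosSemidef := by
    simpa using Matrix.posSemidef_self_mul_conjTranspose X
  set S := CFC.sqrt (X * Xᵀ) with hS
  have hSS : S * S = X * Xᵀ := CFC.sqrt_mul_sqrt_self _ hpos.nonneg
  have hSt : Sᵀ = S := by
    have h1 : S.PosSemidef := Matrix.nonneg_iff_posSemidef.1 (CFC.sqrt_nonneg _)
    simpa using h1.isHermitian.eq
  have hunit : IsUnit S.det := by
    have h1 : IsUnit (X * Xᵀ).det := by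
      rw [← Matrix.isUnit_iff_isUnit_det]
      exact Matrix.isUnit_of_rank_eq_card (by rw [hX, Fintype.card_fin])
    rw [← hSS, Matrix.det_mul] at h1
    exact isUnit_of_mul_isUnit_left h1
  have hT : whitenedTarget X Y * S = Y * Xᵀ := by
    rw [whitenedTarget, Matrix.mul_assoc, Matrix.nonsing_inv_mul _ hunit, Matrix.mul_one]
  have expand : ∀ {k : ℕ} (A B : Matrix (Fin p) (Fin k) ℝ),
      ‖A - B‖ ^ 2 = ‖A‖ ^ 2 - 2 * (A * Bᵀ).trace + (B * Bᵀ).trace := by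
    intro k A B
    have h1 : (Aᵀ * B).trace = (A * Bᵀ).trace := by
      rw [← Matrix.trace_transpose, Matrix.transpose_mul, Matrix.transpose_transpose,
        Matrix.trace_mul_comm]
    have h2 : (Bᵀ * A).trace = (A * Bᵀ).trace := Matrix.trace_mul_comm _ _
    rw [Matrix.frobenius_norm_sq_eq_trace, Matrix.frobenius_norm_sq_eq_trace,
      Matrix.transpose_sub, Matrix.sub_mul, Matrix.mul_sub, Matrix.mul_sub, Matrix.trace_sub,
      Matrix.trace_sub, Matrix.trace_sub, h1, h2, Matrix.trace_mul_comm Bᵀ B]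
    ring
  refine ⟨S, ‖Y‖ ^ 2 - ‖whitenedTarget X Y‖ ^ 2, hunit, fun W => ?_⟩
  have h1 : Y * (W * X)ᵀ = whitenedTarget X Y * (W * S)ᵀ := by
    rw [Matrix.transpose_mul, Matrix.transpose_mul, hSt, ← Matrix.mul_assoc, ← Matrix.mul_assoc,
      hT]
  have h2 : W * X * (W * X)ᵀ = W * S * (W * S)ᵀ := by
    rw [Matrix.transpose_mul, Matrix.transpose_mul, hSt, Matrix.mul_assoc, ← Matrix.mul_assoc X,
      Matrix.mul_assoc W S, ← Matrix.mul_assoc S, hSS]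
  rw [quadLoss, expand, expand, h1, h2]
  ring

end Whitening

/-- Under the assumptions on the singular values, each `r ≤ min p q` marks a gap in the sequence of
singular values: either a gap between distinct positive values, or the last drop to zero. -/
lemma matSingularValue_lt_of_lt {p q r : ℕ} {W : Matrix (Fin p) (Fin q) ℝ} (hr : r ≤ min p q)
    (hpos : ∀ i < min p q, 0 < matSingularValue W i)
    (hdist : ∀ i < min p q, ∀ j < min p q, i ≠ j → matSingularValue W i ≠ matSingularValue W j)
    {i : ℕ} (hi : i < r) : matSingularValue W r < matSingularValue W i := by
  rcases hr.lt_or_eq with h | h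
  · exact lt_of_le_of_ne (LinearMap.singularValues_antitone _ hi.le)
      (hdist r h i (hi.trans h) hi.ne')
  · have h0 : matSingularValue W r = 0 := by
      rw [matSingularValue, LinearMap.singularValues_eq_zero_iff_le_finrank_range, h]
      refine le_min ?_ ?_
      · exact (Submodule.finrank_le _).trans finrank_euclideanSpace_fin.le
      · exact (LinearMap.finrank_range_le _).trans finrank_euclideanSpace_fin.le
    rw [h0]
    exact hpos i (hi.trans_eq h)

/-- The global minima are the parameters of a single matrix, whose rank is the largest one that the
network can reach. -/
theorem exists_globalMinima_eq_preimage {d : ℕ → ℕ} {h n : ℕ} (hh : 0 < h)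
    (X : Matrix (Fin (d 0)) (Fin n) ℝ) (Y : Matrix (Fin (d h)) (Fin n) ℝ)
    (hX : (X * Xᵀ).rank = d 0)
    (hpos : ∀ i < min (d h) (d 0), 0 < matSingularValue (whitenedTarget X Y) i)
    (hdist : ∀ i < min (d h) (d 0), ∀ j < min (d h) (d 0), i ≠ j →
      matSingularValue (whitenedTarget X Y) i ≠ matSingularValue (whitenedTarget X Y) j) :
    ∃ W : Matrix (Fin (d h)) (Fin (d 0)) ℝ, W.rank = minWidth d h ∧
      globalMinima d h X Y = mulMap d h ⁻¹' {W} := by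
  have hp : minWidth d h ≤ d h := minWidth_le d le_rfl
  have hq : minWidth d h ≤ d 0 := minWidth_le d h.zero_le
  obtain ⟨S, c, hS, hloss⟩ := exists_quadLoss_eq_norm_sub_sq X Y hX
  obtain ⟨Z, hZ, hbest⟩ := exists_unique_best_rank_approximation (whitenedTarget X Y) hq
    fun i hi => matSingularValue_lt_of_lt (le_min hp hq) hpos hdist hi
  have hSinv : IsUnit (S⁻¹).det := Matrix.isUnit_nonsing_inv_det _ hS
  have hW : (Z * S⁻¹).rank = minWidth d h := by
    rw [Matrix.rank_mul_eq_left_of_isUnit_det _ _ hSinv, hZ]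
  have hWS : Z * S⁻¹ * S = Z := by
    rw [Matrix.mul_assoc, Matrix.nonsing_inv_mul _ hS, Matrix.mul_one]
  obtain ⟨θ₀, hθ₀⟩ := exists_mulMap_eq d hh (Z * S⁻¹) hW.le
  have hlt : ∀ θ : NetParams d h, mulMap d h θ ≠ Z * S⁻¹ →
      netLoss d h X Y θ₀ < netLoss d h X Y θ := by
    intro θ hθ
    have h1 := hbest (mulMap d h θ * S)
      (by rw [Matrix.rank_mul_eq_left_of_isUnit_det _ _ hS]; exact rank_mulMap_le_minWidth d θ)
      (fun h2 => hθ (by rw [← h2, Matrix.mul_assoc, Matrix.mul_nonsing_inv _ hS, Matrix.mul_one]))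
    rw [netLoss, netLoss, hloss, hloss, hθ₀, hWS]
    have h2 := pow_lt_pow_left₀ h1 (norm_nonneg _) two_ne_zero
    linarith
  refine ⟨Z * S⁻¹, hW, Set.ext fun θ => ⟨fun hθ => ?_, fun hθ θ' => ?_⟩⟩
  · by_contra hne
    exact absurd (hθ θ₀) (not_le.2 (hlt θ hne))
  · have hθ' : mulMap d h θ = mulMap d h θ₀ := (show mulMap d h θ = _ from hθ).trans hθ₀.symm
    have h1 : netLoss d h X Y θ = netLoss d h X Y θ₀ := by rw [netLoss, netLoss, hθ']
    rw [h1]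
    by_cases h2 : mulMap d h θ' = Z * S⁻¹
    · rw [netLoss, netLoss, h2, hθ₀]
    · exact (hlt θ' h2).le

theorem mainTheorem5 (h : ℕ) (hh : 0 < h) (d : ℕ → ℕ) (n : ℕ)
    (X : Matrix (Fin (d 0)) (Fin n) ℝ) (Y : Matrix (Fin (d h)) (Fin n) ℝ)
    (hX : (X * Xᵀ).rank = d 0)
    (hpos : ∀ i < min (d h) (d 0), 0 < matSingularValue (whitenedTarget X Y) i)
    (hdist : ∀ i < min (d h) (d 0), ∀ j < min (d h) (d 0), i ≠ j →
      matSingularValue (whitenedTarget X Y) i ≠ matSingularValue (whitenedTarget X Y) j) :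
    (globalMinima d h X Y).Nonempty ∧
    minWidth d h * (d 0 + d h - minWidth d h) ≤ paramDim d h ∧
    IsEmbeddedSubmanifold (paramDim d h - minWidth d h * (d 0 + d h - minWidth d h))
      (globalMinima d h X Y) ∧
    IsRegularLevelSet (mulMap d h)
      {W : Matrix (Fin (d h)) (Fin (d 0)) ℝ | W.rank = minWidth d h}
      (minWidth d h * (d 0 + d h - minWidth d h)) (globalMinima d h X Y) ∧
    (minWidth d h = min (d h) (d 0) →
      ∀ θ ∈ globalMinima d h X Y, Function.Surjective (fderiv ℝ (mulMap d h) θ)) := by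

  obtain ⟨W, hW, hM⟩ := exists_globalMinima_eq_preimage hh X Y hX hpos hdist
  have hp : minWidth d h ≤ d h := minWidth_le d le_rfl
  have hq : minWidth d h ≤ d 0 := minWidth_le d h.zero_le
  obtain ⟨θ₀, hθ₀⟩ := exists_mulMap_eq d hh W hW.le
  have hrank : ∀ θ ∈ globalMinima d h X Y, (mulMap d h θ).rank = minWidth d h := by
    intro θ hθ
    rw [hM] at hθ
    rw [show mulMap d h θ = W from hθ, hW]
  refine ⟨⟨θ₀, hM ▸ hθ₀⟩, rank_dim_le_paramDim hh (hθ₀ ▸ hW), ?_, ⟨?_, ⟨W, hW, hM⟩,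
    {θ | (mulMap d h θ).rank = minWidth d h}, isOpen_setOf_rank_mulMap_eq d h, hrank,
    fun _ hθ => hθ, (contDiff_mulMap d h).contDiffOn,
    fun θ hθ => finrank_range_fderiv_mulMap hh (hrank θ hθ)⟩, ?_⟩
  · rw [hM]
    exact isEmbeddedSubmanifold_preimage_mulMap hh hW
  · exact isEmbeddedSubmanifold_setOf_rank_eq hp hq
  · intro hfill θ hθ
    have h1 := finrank_range_fderiv_mulMap hh (hrank θ hθ)
    refine LinearMap.range_eq_top.1 (Submodule.eq_top_of_finrank_eq (h1.trans ?_))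
    -- one of the factors `d_h - r`, `d_0 - r` of the codimension vanishes
    have h2 := mul_eq_rank_dim_add hp hq
    have h3 : (d h - minWidth d h) * (d 0 - minWidth d h) = 0 := by
      rcases min_choice (d h) (d 0) with h4 | h4 <;> rw [hfill, h4] <;> simp
    rw [Module.finrank_matrix]
    simp only [Fintype.card_fin, Module.finrank_self, mul_one]
    omega
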